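/- A (simple) temporal graph $\mathcal G=(G,\lambda)$ consists of a finite simple undirected graph $G=(V,E)$ and a labelling $\lambda:E\to\mathbb N$. Write $n=|V|$, $m=|E|$, and let $k$ be the number of monolabel triangles of $\mathcal G$, that is, triangles of $G$ whose three edges have the same label. An orientation of $G$ is a set $O$ of ordered pairs containing exactly one of $(a,b)$, $(b,a)$ for each edge $ab\in E$ and nothing else; it is a temporal transitive orientation (TTO) of $\mathcal G$ if whenever $(a,b)\in O$ and $(b,c)\in O$ with $\lambda(ab)\le\lambda(bc)$, then $(a,c)\in O$ and $\lambda(ac)\ge\lambda(bc)$. $\mathcal G$ is a T-comparability temporal graph if it admits a TTO. Theorem. The recognition problem for T-comparability temporal graphs can be solved in time $\max\{O(nm),\min\{O(kn),O(m^2)\}\}$. Precisely: there are a single program for the unit-cost random access machine (constants, sums, truncated differences, products, comparisons, branching, loops, and random access to memory that is initially $0$ outside the input) and a constant $C$ such that for every temporal graph $\mathcal G$ on the vertex set $\{0,\dots,n-1\}$ and every $W\in\mathbb N$ bounding its labels, given by $n$, $m$ and a list of its edges with their labels (each edge once, in any order, with its endpoints in either order), the program halts after at most $$C\cdot\bigl(\max\{nm,\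 \min\{kn,\ m^2\}\}+1\bigr)$$ steps with output $1$ if $\mathcal G$ is a T-comparability temporal graph and $0$ if it is not, while all numbers handled during the run are at most $(n+W+2)^C$. -/

import Mathlib

/-- A (simple) temporal graph `(G, lam)`: an undirected graph with one time-label on every edge. -/
structure TemporalGraph (V : Type*) where
  graph : SimpleGraph V
  label : graph.edgeSet → ℕ

namespace TemporalGraph

variable {V : Type*} (𝒢 : TemporalGraph V)

/-- The time-label of the edge `ab`. -/
def lab {a b : V} (h : 𝒢.graph.Adj a b) : ℕ :=
  𝒢.label ⟨s(a, b), (SimpleGraph.mem_edgeSet 𝒢.graph).2 h⟩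

/-- An orientation consists of exactly one of the pairs `(a, b)`, `(b, a)` for each edge `ab`. -/
def IsOrientation (O : Set (V × V)) : Prop :=
  (∀ a b, (a, b) ∈ O → 𝒢.graph.Adj a b) ∧
    ∀ a b, 𝒢.graph.Adj a b → Xor ((a, b) ∈ O) ((b, a) ∈ O)

/-- A temporal transitive orientation (TTO): an orientation such that, whenever `(a, b)` and
`(b, c)` belong to it and the label of `ab` is at most that of `bc`, the pair `(a, c)` belongs to
it as well and the label of `ac` is at least that of `bc`. -/
def IsTTO (O : Set (V × V)) : Prop :=
  𝒢.IsOrientation O ∧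
    ∀ (a b c : V) (hab : 𝒢.graph.Adj a b) (hbc : 𝒢.graph.Adj b c),
      (a, b) ∈ O → (b, c) ∈ O → 𝒢.lab hab ≤ 𝒢.lab hbc →
        (a, c) ∈ O ∧ ∃ hac : 𝒢.graph.Adj a c, 𝒢.lab hbc ≤ 𝒢.lab hac

/-- A temporal graph is T-comparability if it admits a temporal transitive orientation. -/
def IsTComparability : Prop :=
  ∃ O : Set (V × V), 𝒢.IsTTO O

/-- The number `m` of edges. -/
noncomputable def numEdges : ℕ :=
  𝒢.graph.edgeSet.ncard

/-- The monolabel triangles, as sets of three vertices. -/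
def monolabelTriangles : Set (Set V) :=
  {T | ∃ (a b c : V) (hab : 𝒢.graph.Adj a b) (hbc : 𝒢.graph.Adj b c) (hac : 𝒢.graph.Adj a c),
    T = {a, b, c} ∧ 𝒢.lab hab = 𝒢.lab hbc ∧ 𝒢.lab hbc = 𝒢.lab hac}

/-- The number `k` of monolabel triangles. -/
noncomputable def numMonolabelTriangles : ℕ :=
  𝒢.monolabelTriangles.ncard

/-- `L` lists every edge `uv` of the temporal graph exactly once, as a triple `(u, v, t)` with `t`
its label; the order of the list, and of `u` and `v` in a triple, is arbitrary. -/
def IsEdgeList (L : List (V × V × ℕ)) : Prop :=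
  (L.map fun x => s(x.1, x.2.1)).Nodup ∧
    ∀ (e : Sym2 V) (t : ℕ),
      (∃ x ∈ L, s(x.1, x.2.1) = e ∧ x.2.2 = t) ↔ ∃ h : e ∈ 𝒢.graph.edgeSet, 𝒢.label ⟨e, h⟩ = t

end TemporalGraph

/-! ### Random access machine

Structured programs over registers and randomly accessible arrays of natural numbers, with unit cost
per elementary operation. A program is a fixed finite text and names finitely many registers and
arrays (which could be interleaved in a single memory). All numbers handled during a run have to
stay below a bound `B`, the word size: an operation that exceeds it has no result. -/

namespace RAM

/-- A configuration: the contents of the registers, and of cell `i` of array `a` for all `a`, `i`. -/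
structure State where
  reg : ℕ → ℕ
  arr : ℕ → ℕ → ℕ

/-- Expressions: constants, registers, array reads, sum, truncated difference, product, and
the comparisons `<` and `=` with value `1` or `0`. -/
inductive Expr where
  | lit (c : ℕ)
  | reg (x : ℕ)
  | read (a : ℕ) (i : Expr)
  | add (e f : Expr)
  | sub (e f : Expr)
  | mul (e f : Expr)
  | lt (e f : Expr)
  | eq (e f : Expr)

/-- The value of an expression. -/
def Expr.eval (s : State) : Expr → ℕ
  | lit c => c
  | reg x => s.reg x
  | read a i => s.arr a (i.eval s)
  | add e f => e.eval s + f.eval s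
  | sub e f => e.eval s - f.eval s
  | mul e f => e.eval s * f.eval s
  | lt e f => if e.eval s < f.eval s then 1 else 0
  | eq e f => if e.eval s = f.eval s then 1 else 0

/-- The number of elementary operations that evaluate an expression. -/
def Expr.cost : Expr → ℕ
  | lit _ => 1
  | reg _ => 1
  | read _ i => i.cost + 1
  | add e f => e.cost + f.cost + 1
  | sub e f => e.cost + f.cost + 1
  | mul e f => e.cost + f.cost + 1
  | lt e f => e.cost + f.cost + 1
  | eq e f => e.cost + f.cost + 1

/-- No value that occurs while the expression is evaluated exceeds `B`. -/
def Expr.Fits (B : ℕ) (s : State) : Expr → Prop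
  | lit c => c ≤ B
  | reg x => s.reg x ≤ B
  | read a i => i.Fits B s ∧ s.arr a (i.eval s) ≤ B
  | add e f => e.Fits B s ∧ f.Fits B s ∧ e.eval s + f.eval s ≤ B
  | sub e f => e.Fits B s ∧ f.Fits B s
  | mul e f => e.Fits B s ∧ f.Fits B s ∧ e.eval s * f.eval s ≤ B
  | lt e f => e.Fits B s ∧ f.Fits B s ∧ 1 ≤ B
  | eq e f => e.Fits B s ∧ f.Fits B s ∧ 1 ≤ B

/-- Programs. -/
inductive Program where
  | skip
  | assign (x : ℕ) (e : Expr)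
  | write (a : ℕ) (i e : Expr)
  | seq (p q : Program)
  | cond (e : Expr) (p q : Program)
  | loop (e : Expr) (p : Program)

/-- `x := v`. -/
def State.setReg (s : State) (x v : ℕ) : State :=
  { s with reg := Function.update s.reg x v }

/-- `a[i] := v`. -/
def State.setArr (s : State) (a i v : ℕ) : State :=
  { s with arr := Function.update s.arr a (Function.update (s.arr a) i v) }

/-- `Exec B p s t s'`: with word bound `B`, the program `p` started in configuration `s` halts in
configuration `s'` after exactly `t` elementary steps, without overflow. A test succeeds if its
value is not `0`; `loop e p` repeats `p` as long as the test `e` succeeds. -/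
inductive Exec (B : ℕ) : Program → State → ℕ → State → Prop where
  | skip (s : State) : Exec B .skip s 1 s
  | assign (s : State) (x : ℕ) (e : Expr) (h : e.Fits B s) :
      Exec B (.assign x e) s (e.cost + 1) (s.setReg x (e.eval s))
  | write (s : State) (a : ℕ) (i e : Expr) (hi : i.Fits B s) (he : e.Fits B s) :
      Exec B (.write a i e) s (i.cost + e.cost + 1) (s.setArr a (i.eval s) (e.eval s))
  | seq {p q : Program} {s s' s'' : State} {t t' : ℕ} (hp : Exec B p s t s')
      (hq : Exec B q s' t' s'') : Exec B (.seq p q) s (t + t') s''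
  | cond_true {e : Expr} {p q : Program} {s s' : State} {t : ℕ} (h : e.Fits B s)
      (he : e.eval s ≠ 0) (hp : Exec B p s t s') : Exec B (.cond e p q) s (e.cost + 1 + t) s'
  | cond_false {e : Expr} {p q : Program} {s s' : State} {t : ℕ} (h : e.Fits B s)
      (he : e.eval s = 0) (hq : Exec B q s t s') : Exec B (.cond e p q) s (e.cost + 1 + t) s'
  | loop_true {e : Expr} {p : Program} {s s' s'' : State} {t t' : ℕ} (h : e.Fits B s)
      (he : e.eval s ≠ 0) (hp : Exec B p s t s') (hl : Exec B (.loop e p) s' t' s'') :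
      Exec B (.loop e p) s (e.cost + 1 + t + t') s''
  | loop_false {e : Expr} {p : Program} {s : State} (h : e.Fits B s) (he : e.eval s = 0) :
      Exec B (.loop e p) s (e.cost + 1) s

/-- The start configuration for an edge list `L` on the vertices `0, …, n - 1`: registers `0` and
`1` hold `n` and the length of `L`; cell `i` of the arrays `0`, `1`, `2` holds the first endpoint,
the second endpoint and the label of the `i`-th edge of `L`; everything else is `0`. -/
def inputState (n : ℕ) (L : List (Fin n × Fin n × ℕ)) : State where
  reg x := if x = 0 then n else if x = 1 then L.length else 0
  arr a i :=
    match L[i]? with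
    | none => 0
    | some (u, v, t) =>
      if a = 0 then (u : ℕ) else if a = 1 then (v : ℕ) else if a = 2 then t else 0

end RAM

/-!
The program decides the edges one after the other and commits to each choice, in total time
`O(n m)`; this is below the bound claimed, whatever the number of monolabel triangles.

Write `ℓ a b` for the label of `ab` plus one, and `0` for a non-edge. In a temporal transitive
orientation, an arc `a → b` forces other arcs in two ways. If `b → w` would violate the condition on
labels after `a → b`, the opposite arc is forced, and likewise for an arc that would precede
`a → b`; and in a monolabel triangle two consecutive arcs force the third (`ForcesIn`, `ForcesOut`).
Conversely, an orientation of all edges that is closed under forcing is a TTO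
(`IsPartialTTO.isWeightTTO`).

No choice has ever to be revised, by `IsPartialTTO.exists_extension`: if there is a TTO `O` at all,
then every partial orientation `S` closed under forcing extends to one. The naive union, `S` on its
edges and `O` on the others, may contain cyclic monolabel triangles. Instead an undecided edge `xc`
is compared through the representatives of its ends (`Represents`): those of `x` are `x` itself and
the heads `y` of arcs `x → y` of `S` in monolabel triangles `xyc` with `yc` undecided. All edges
between representatives of `x` and of `c` are undecided and have the label of `xc`, and `x` precedes
`c` in the new orientation if some representative of `x` precedes, in `O`, all representatives of
`c` (`modified`). By transitivity, `O` has no directed 4-cycle between the representatives, so that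
every edge obtains exactly one orientation; the conditions on labels and on triangles are inherited
from `O`.

For an undecided edge `uv`, the program therefore computes the arcs forced by `u → v` and those
forced by `v → u` on top of the committed ones. Expanding one arc, that is, finding the arcs which
it forces, takes `O(n)` steps. If one of the computations ends without a conflict, its arcs are
committed (`Propagation.isPartialTTO`); if both meet a pair of opposite arcs, there is no TTO
(`TTOProgram.not_exists_isWeightTTO`). The two computations are run alternately, one arc at a
time, and stopped when the first succeeds. So the time spent on `uv` is `O(n)` per newly
committed arc (`TTOProgram.decideEdge_spec`), except for the last edge if there is no TTO; since at
most `2m` arcs are ever committed, the sum is `O(n m)`. An expanded arc need not be revisited when a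
later arc forms a monolabel triangle with it, since the forcing is then noticed from the later arc
(`Expanded.snoc`).
-/

/-! ### Forcing, and the extension of partial orientations -/

/-- A temporal transitive orientation in terms of a weight function `ℓ`: the weight of an edge is
its label plus one, and non-edges have weight `0`. -/
structure IsWeightTTO {V : Type*} (ℓ : V → V → ℕ) (O : V → V → Prop) : Prop where
  pos : ∀ {a b}, O a b → 0 < ℓ a b
  asymm : ∀ {a b}, O a b → ¬ O b a
  total : ∀ {a b}, 0 < ℓ a b → O a b ∨ O b a
  trans : ∀ {a b c}, O a b → O b c → ℓ a b ≤ ℓ b c → O a c ∧ ℓ b c ≤ ℓ a c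

/-- The arc `a → b` forces `w → b`, either since `a → b → w` is forbidden, or by
transitivity of `w → a → b` in a monolabel triangle. -/
def ForcesIn {V : Type*} (ℓ : V → V → ℕ) (S : V → V → Prop) (a b w : V) : Prop :=
  (ℓ a b ≤ ℓ b w ∧ ℓ a w < ℓ b w) ∨ (ℓ a w = ℓ a b ∧ ℓ b w = ℓ a b ∧ S w a)

/-- The arc `a → b` forces `a → w`, either since `w → a → b` is forbidden, or by
transitivity of `a → b → w` in a monolabel triangle. -/
def ForcesOut {V : Type*} (ℓ : V → V → ℕ) (S : V → V → Prop) (a b w : V) : Prop :=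
  (0 < ℓ a w ∧ ℓ a w ≤ ℓ a b ∧ ℓ b w < ℓ a b) ∨ (ℓ a w = ℓ a b ∧ ℓ b w = ℓ a b ∧ S b w)

/-- A set of arcs that contains every arc forced by its members. -/
def ForcingClosed {V : Type*} (ℓ : V → V → ℕ) (S : V → V → Prop) : Prop :=
  ∀ ⦃a b⦄, S a b → ∀ w, (ForcesIn ℓ S a b w → S w b) ∧ (ForcesOut ℓ S a b w → S a w)

/-- A partial orientation of the edges of `ℓ` that is closed under forcing. -/
structure IsPartialTTO {V : Type*} (ℓ : V → V → ℕ) (S : V → V → Prop) : Prop where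
  pos : ∀ {a b}, S a b → 0 < ℓ a b
  asymm : ∀ {a b}, S a b → ¬ S b a
  closed : ForcingClosed ℓ S

/-- The edge `ab` has no orientation in `S`. -/
def Undecided {V : Type*} (ℓ : V → V → ℕ) (S : V → V → Prop) (a b : V) : Prop :=
  0 < ℓ a b ∧ ¬ S a b ∧ ¬ S b a

/-- The vertices that represent `x` when the edge `xc` is compared: `x` itself, and the heads `y`
of arcs `x → y` of `S` that form with `c` a monolabel triangle whose edge `yc` is undecided. -/
def Represents {V : Type*} (ℓ : V → V → ℕ) (S : V → V → Prop) (x c y : V) : Prop :=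
  y = x ∨ (S x y ∧ ℓ x y = ℓ x c ∧ ℓ y c = ℓ x c ∧ Undecided ℓ S y c)

/-- The orientation `O`, modified so as to contain `S`: an undecided edge `xc` is oriented from `x`
to `c` if some representative of `x` precedes, in `O`, all representatives of `c`. -/
def modified {V : Type*} (ℓ : V → V → ℕ) (S O : V → V → Prop) (x c : V) : Prop :=
  S x c ∨ (Undecided ℓ S x c ∧ ∃ y, Represents ℓ S x c y ∧ ∀ z, Represents ℓ S c x z → O y z)

section

variable {V : Type*} {ℓ : V → V → ℕ} {S O : V → V → Prop}

/-- Conversely to `IsWeightTTO.forcingClosed`, a total forcing-closed orientation is a TTO. -/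
theorem IsPartialTTO.isWeightTTO (hℓ : ∀ a b, ℓ a b = ℓ b a) (hS : IsPartialTTO ℓ S)
    (ht : ∀ a b, 0 < ℓ a b → S a b ∨ S b a) : IsWeightTTO ℓ S := by
  refine ⟨hS.pos, hS.asymm, fun {a b} h => ht a b h, fun {a b c} hab hbc h => ?_⟩
  have h1 : ℓ b c ≤ ℓ a c := by
    by_contra hlt
    exact hS.asymm hbc (((hS.closed hab c).1) (Or.inl ⟨h, by omega⟩))
  refine ⟨?_, h1⟩
  rcases ht a c ((hS.pos hbc).trans_le h1) with hac | hca
  · exact hac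
  · have e1 := hℓ a b
    have e2 := hℓ a c
    rcases lt_or_ge (ℓ b a) (ℓ c a) with hlt | hge
    · exact (hS.closed hbc a).1 (Or.inl ⟨by omega, hlt⟩)
    · exact (hS.closed hab c).2 (Or.inr ⟨by omega, by omega, hbc⟩)

theorem IsWeightTTO.forcingClosed (hℓ : ∀ a b, ℓ a b = ℓ b a) (hO : IsWeightTTO ℓ O) :
    ForcingClosed ℓ O := by
  intro a b hab w
  have e1 := hℓ a w
  have e2 := hℓ b w
  constructor
  · rintro (⟨h1, h2⟩ | ⟨h1, h2, h3⟩)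
    · refine (hO.total (a := w) (b := b) (by omega)).resolve_right fun hbw => ?_
      have := (hO.trans hab hbw h1).2
      omega
    · exact (hO.trans h3 hab (by omega)).1
  · rintro (⟨h0, h1, h2⟩ | ⟨h1, h2, h3⟩)
    · refine (hO.total (a := a) (b := w) h0).resolve_right fun hwa => ?_
      have := (hO.trans hwa hab (by omega)).2
      have := hℓ w b
      omega
    · exact (hO.trans hab h3 (by omega)).1

namespace IsPartialTTO

/-- If `b → c` is forbidden after `a → b`, then `c → b`. -/
theorem fwd (hS : IsPartialTTO ℓ S) {a b c : V} (h : S a b) (h1 : ℓ a b ≤ ℓ b c)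
    (h2 : ℓ a c < ℓ b c) : S c b :=
  (hS.closed h c).1 (Or.inl ⟨h1, h2⟩)

/-- If `c → a` is forbidden before `a → b`, then `a → c`. -/
theorem bwd (hS : IsPartialTTO ℓ S) {a b c : V} (h : S a b) (h0 : 0 < ℓ a c)
    (h1 : ℓ a c ≤ ℓ a b) (h2 : ℓ b c < ℓ a b) : S a c :=
  (hS.closed h c).2 (Or.inl ⟨h0, h1, h2⟩)

/-- Transitivity in a monolabel triangle. -/
theorem tri (hS : IsPartialTTO ℓ S) {a b c : V} (h : S a b) (h' : S b c)
    (h1 : ℓ a c = ℓ a b) (h2 : ℓ b c = ℓ a b) : S a c :=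
  (hS.closed h c).2 (Or.inr ⟨h1, h2, h'⟩)

end IsPartialTTO

theorem Undecided.symm (hℓ : ∀ a b, ℓ a b = ℓ b a) {a b : V} (h : Undecided ℓ S a b) :
    Undecided ℓ S b a :=
  ⟨hℓ a b ▸ h.1, h.2.2, h.2.1⟩

/-- If `x → y` and `xc` is an undecided edge of the same weight, then `yc` has this weight too, for
otherwise `x → y` would force an orientation of `xc`. -/
theorem weight_eq_of_undecided (hℓ : ∀ a b, ℓ a b = ℓ b a) (hS : IsPartialTTO ℓ S) {x y c : V}
    (hxy : S x y) (hxc : Undecided ℓ S x c) (h : ℓ x c = ℓ x y) : ℓ y c = ℓ x y := by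
  have := hS.pos hxy
  have e1 := hℓ x y
  have e2 := hℓ x c
  have e3 := hℓ y c
  rcases lt_trichotomy (ℓ y c) (ℓ x y) with hlt | heq | hgt
  · exact absurd (hS.bwd hxy (by omega) (by omega) hlt) hxc.2.1
  · exact heq
  · have h1 : S c y := hS.fwd hxy (by omega) (by omega)
    exact absurd (hS.bwd h1 (by omega) (by omega) (by omega)) hxc.2.2

/-- Representatives of the two ends of an undecided edge form an undecided edge of the same
weight. -/
theorem Represents.cross (hℓ : ∀ a b, ℓ a b = ℓ b a) (hS : IsPartialTTO ℓ S) {x c y z : V}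
    (hxc : Undecided ℓ S x c) (hy : Represents ℓ S x c y) (hz : Represents ℓ S c x z) :
    ℓ y z = ℓ x c ∧ Undecided ℓ S y z := by
  have e1 := hℓ x c
  rcases hy with rfl | ⟨hxy, hy1, hy2, hyc⟩
  · rcases hz with rfl | ⟨hcz, hz1, hz2, hzx⟩
    · exact ⟨rfl, hxc⟩
    · have := hℓ y z
      exact ⟨by omega, hzx.symm hℓ⟩
  · rcases hz with rfl | ⟨hcz, hz1, hz2, hzx⟩
    · exact ⟨hy2, hyc⟩
    · have e2 := hℓ x z
      have e3 := hℓ y c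
      have h : ℓ y z = ℓ x y := weight_eq_of_undecided hℓ hS hxy (hzx.symm hℓ) (by omega)
      have e4 := hℓ y z
      refine ⟨by omega, by have := hS.pos hxy; omega, fun hyz => ?_, fun hzy => ?_⟩
      · exact hzx.2.2 (hS.tri hxy hyz (by omega) (by omega))
      · exact hyc.2.2 (hS.tri hcz hzy (by omega) (by omega))

/-- The weight function `ℓ` is constant on the pairs of representatives, where `O` has no directed
4-cycle by transitivity. So if no representative of `x` precedes all those of `c`, then one of `c`
precedes all those of `x`. -/
theorem modified_total [Finite V] (hℓ : ∀ a b, ℓ a b = ℓ b a) (hS : IsPartialTTO ℓ S)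
    (hO : IsWeightTTO ℓ O) {x c : V} (h : 0 < ℓ x c) :
    modified ℓ S O x c ∨ modified ℓ S O c x := by
  by_cases h1 : S x c
  · exact Or.inl (Or.inl h1)
  by_cases h2 : S c x
  · exact Or.inr (Or.inl h2)
  have hU : Undecided ℓ S x c := ⟨h, h1, h2⟩
  by_contra hcon
  rw [not_or] at hcon
  have hx : ∀ y, Represents ℓ S x c y → ∃ z, Represents ℓ S c x z ∧ O z y := by
    intro y hy
    by_contra hne
    refine hcon.1 (Or.inr ⟨hU, y, hy, fun z hz => ?_⟩)
    have hyz := Represents.cross hℓ hS hU hy hz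
    exact (hO.total hyz.2.1).resolve_right fun hzy => hne ⟨z, hz, hzy⟩
  have hc : ∀ z, Represents ℓ S c x z → ∃ y, Represents ℓ S x c y ∧ O y z := by
    intro z hz
    by_contra hne
    refine hcon.2 (Or.inr ⟨hU.symm hℓ, z, hz, fun y hy => ?_⟩)
    have hyz := Represents.cross hℓ hS hU hy hz
    exact (hO.total hyz.2.1).resolve_left fun hyz' => hne ⟨y, hy, hyz'⟩
  -- a representative of `x` that precedes as many representatives of `c` as possible
  obtain ⟨y, hy, hmax⟩ := Set.exists_max_image {y | Represents ℓ S x c y}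
    (fun y => {z | Represents ℓ S c x z ∧ O y z}.ncard) (Set.toFinite _) ⟨x, Or.inl rfl⟩
  obtain ⟨z, hz, hzy⟩ := hx y hy
  obtain ⟨y', hy', hy'z⟩ := hc z hz
  refine (hmax y' hy').not_gt (Set.ncard_lt_ncard ⟨?_, fun hsub => ?_⟩ (Set.toFinite _))
  · rintro z' ⟨hz', hyz'⟩
    have w1 := (Represents.cross hℓ hS hU hy hz).1
    have w2 := (Represents.cross hℓ hS hU hy hz').1
    have w3 := (Represents.cross hℓ hS hU hy' hz).1
    have w4 := Represents.cross hℓ hS hU hy' hz'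
    have e1 := hℓ z y
    have e2 := hℓ z' y'
    refine ⟨hz', (hO.total w4.2.1).resolve_right fun hz'y' => ?_⟩
    exact hO.asymm (hO.trans hyz' hz'y' (by omega)).1 (hO.trans hy'z hzy (by omega)).1
  · exact hO.asymm hzy (hsub ⟨hz, hy'z⟩).2

theorem modified_asymm (hS : IsPartialTTO ℓ S) (hO : IsWeightTTO ℓ O)
    {x c : V} (h : modified ℓ S O x c) : ¬ modified ℓ S O c x := by
  rintro h'
  rcases h with h | ⟨hU, y, hy, hyz⟩
  · rcases h' with h' | ⟨hU, -⟩
    · exact hS.asymm h h'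
    · exact hU.2.2 h
  · rcases h' with h' | ⟨-, z, hz, hzy⟩
    · exact hU.2.2 h'
    · exact hO.asymm (hyz z hz) (hzy y hy)

/-- Representatives transfer between two edges `ba`, `bc` of equal weight whose other ends are
not joined by an edge of at least that weight. -/
theorem Represents.transfer (hℓ : ∀ a b, ℓ a b = ℓ b a) (hS : IsPartialTTO ℓ S) {a b c z : V}
    (hbc : Undecided ℓ S b c) (h : ℓ b a = ℓ b c) (hac : ℓ a c < ℓ b c)
    (hz : Represents ℓ S b a z) : Represents ℓ S b c z := by
  rcases hz with rfl | ⟨hbz, h1, h2, hza⟩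
  · exact Or.inl rfl
  · have h3 := weight_eq_of_undecided hℓ hS hbz hbc (by omega)
    have e1 := hℓ a z
    have e2 := hℓ c z
    have e3 := hℓ a c
    have := hS.pos hbz
    refine Or.inr ⟨hbz, by omega, by omega, by omega, fun hzc => ?_, fun hcz => ?_⟩
    · exact hza.2.1 (hS.bwd hzc (by omega) (by omega) (by omega))
    · exact hza.2.2 (hS.fwd hcz (by omega) (by omega))

/-- The modified orientation satisfies the condition on labels. -/
theorem modified_not_forbidden (hℓ : ∀ a b, ℓ a b = ℓ b a) (hS : IsPartialTTO ℓ S)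
    (hO : IsWeightTTO ℓ O) {a b c : V} (hab : modified ℓ S O a b) (hbc : modified ℓ S O b c)
    (h : ℓ a b ≤ ℓ b c) : ℓ b c ≤ ℓ a c := by
  by_contra! hac
  have e1 := hℓ a b
  have e2 := hℓ b c
  have e3 := hℓ a c
  have hbcU : Undecided ℓ S b c ∧
      ∃ y, Represents ℓ S b c y ∧ ∀ z, Represents ℓ S c b z → O y z := by
    refine hbc.resolve_left fun hb => modified_asymm hS hO hab (Or.inl ?_)
    have : 0 < ℓ a b := hab.elim hS.pos fun h => h.1.1
    exact hS.bwd hb (by omega) (by omega) (by omega)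
  have habU : Undecided ℓ S a b ∧ ∃ y, Represents ℓ S a b y ∧ ∀ z, Represents ℓ S b a z → O y z :=
    hab.resolve_left fun ha => hbcU.1.2.2 (hS.fwd ha h hac)
  obtain ⟨hU1, y, hy, hyz⟩ := habU
  obtain ⟨hU2, u, hu, huw⟩ := hbcU
  have p1 := hU1.1
  have huc := Represents.cross hℓ hS hU2 hu (Or.inl rfl)
  have f1 := hℓ u c
  rcases h.lt_or_eq with hlt | heq
  · -- the representative of `b` towards `c` is `b`
    have hub : u = b := by
      rcases hu with hu | ⟨hbu, h1, h2, -⟩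
      · exact hu
      · exfalso
        have f2 := hℓ a u
        have f3 := hℓ b u
        have h3 : ℓ b c ≤ ℓ u a := by
          by_contra hlt'
          exact hU1.2.2 (hS.bwd hbu (by omega) (by omega) (by omega))
        have h4 : S a u := hS.fwd hbu (by omega) (by omega)
        have h5 : ℓ u a = ℓ b c := by
          by_contra hne
          exact hU1.2.1 (hS.bwd h4 (by omega) (by omega) (by omega))
        exact huc.2.2.2 (hS.fwd h4 (by omega) (by omega))
    subst hub
    have hyb := hyz u (Or.inl rfl)
    have huc' := huw c (Or.inl rfl)
    rcases hy with rfl | ⟨hay, h1, h2, -⟩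
    · have := (hO.trans hyb huc' h).2
      omega
    · have h3 := (hO.trans hyb huc' (by omega)).2
      have f2 := hℓ c y
      have f3 := hℓ y u
      have h4 : S c y := hS.fwd hay (by omega) (by omega)
      exact hU2.2.2 (hS.bwd h4 (by omega) (by omega) (by omega))
  · have hu' : Represents ℓ S b a u :=
      Represents.transfer hℓ hS (hU1.symm hℓ) (by omega) (by omega) hu
    have hyu := hyz u hu'
    have huc' := huw c (Or.inl rfl)
    have hyu' := (Represents.cross hℓ hS hU1 hy hu').1
    have h3 := hO.trans hyu huc' (by omega)
    rcases hy with rfl | ⟨hay, h1, h2, hyb⟩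
    · omega
    · have f2 := hℓ c y
      have f3 := hℓ y b
      have h4 : S c y := hS.fwd hay (by omega) (by omega)
      have h5 : ℓ c y = ℓ a b := by
        by_contra hne
        exact hU2.2.2 (hS.bwd h4 (by omega) (by omega) (by omega))
      exact hO.asymm hyu (huw y (Or.inr ⟨h4, by omega, by omega, hyb⟩))

/-- A monolabel triangle with one arc in `S` does not become cyclic. -/
theorem modified_triangle_aux (hℓ : ∀ a b, ℓ a b = ℓ b a) (hS : IsPartialTTO ℓ S)
    (hO : IsWeightTTO ℓ O) {a b c : V} (h1 : ℓ b c = ℓ a b) (h2 : ℓ c a = ℓ a b)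
    (hab : S a b) (hbc : modified ℓ S O b c) : ¬ modified ℓ S O c a := by
  intro hca
  have e1 := hℓ a b
  have e2 := hℓ b c
  have e3 := hℓ a c
  rcases hbc with hbc | ⟨hU2, u, hu, huw⟩
  · exact modified_asymm hS hO hca (Or.inl (hS.tri hab hbc (by omega) (by omega)))
  rcases hca with hca | ⟨hU3, v, hv, hvw⟩
  · exact hU2.2.2 (hS.tri hca hab (by omega) (by omega))
  have hb : Represents ℓ S a c b := Or.inr ⟨hab, by omega, by omega, hU2⟩
  have hu' : Represents ℓ S a c u := by
    rcases hu with rfl | ⟨hbu, h3, h4, huc⟩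
    · exact hb
    · have f1 := hℓ a u
      have f2 := hℓ b u
      have f3 := hℓ c u
      have p := hS.pos hab
      have h5 : ℓ a u = ℓ a b := by
        rcases lt_trichotomy (ℓ a u) (ℓ a b) with hlt | heq | hgt
        · exact absurd (hS.fwd hab (by omega) (by omega)) (hS.asymm hbu)
        · exact heq
        · have h6 : S a u := hS.fwd hbu (by omega) (by omega)
          exact absurd (hS.bwd h6 (by omega) (by omega) (by omega)) hU3.2.2
      exact Or.inr ⟨hS.tri hab hbu (by omega) (by omega), by omega, by omega, huc⟩
  have hv' : Represents ℓ S c b v := by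
    rcases hv with rfl | ⟨hcv, h3, h4, hva⟩
    · exact Or.inl rfl
    · have := Represents.cross hℓ hS hU3 (Or.inr ⟨hcv, h3, h4, hva⟩) hb
      exact Or.inr ⟨hcv, by omega, by omega, this.2⟩
  exact hO.asymm (hvw u hu') (huw v hv')

/-- In an undecided monolabel triangle `abc`, a representative of `b` towards `c` is one
towards `a`, or else also a representative of `a` towards `c`. -/
theorem Represents.triangle (hℓ : ∀ a b, ℓ a b = ℓ b a) (hS : IsPartialTTO ℓ S) {a b c u : V}
    (h1 : ℓ b c = ℓ a b) (h2 : ℓ c a = ℓ a b) (hab : Undecided ℓ S a b)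
    (hu : Represents ℓ S b c u) : Represents ℓ S b a u ∨ Represents ℓ S a c u := by
  have e1 := hℓ a b
  have e3 := hℓ a c
  rcases hu with rfl | ⟨hbu, h3, h4, huc⟩
  · exact Or.inl (Or.inl rfl)
  · have h5 := weight_eq_of_undecided hℓ hS hbu (hab.symm hℓ) (by omega)
    have f1 := hℓ a u
    have f2 := hℓ b u
    have := hS.pos hbu
    by_cases hau : S a u
    · exact Or.inr (Or.inr ⟨hau, by omega, by omega, huc⟩)
    · refine Or.inl (Or.inr ⟨hbu, by omega, by omega, by omega, fun hua => ?_, hau⟩)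
      exact hab.2.2 (hS.tri hbu hua (by omega) (by omega))

/-- No monolabel triangle becomes cyclic. -/
theorem modified_triangle (hℓ : ∀ a b, ℓ a b = ℓ b a) (hS : IsPartialTTO ℓ S)
    (hO : IsWeightTTO ℓ O) {a b c : V} (h1 : ℓ b c = ℓ a b) (h2 : ℓ c a = ℓ a b)
    (hab : modified ℓ S O a b) (hbc : modified ℓ S O b c) : ¬ modified ℓ S O c a := by
  intro hca
  rcases hab with hab | ⟨hU1, y, hy, hyw⟩
  · exact modified_triangle_aux hℓ hS hO h1 h2 hab hbc hca
  rcases hbc with hbc | ⟨hU2, u, hu, huw⟩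
  · exact modified_triangle_aux hℓ hS hO (by omega) (by omega) hbc hca (Or.inr ⟨hU1, y, hy, hyw⟩)
  rcases hca with hca | ⟨hU3, v, hv, hvw⟩
  · exact modified_triangle_aux hℓ hS hO (by omega) (by omega) hca (Or.inr ⟨hU1, y, hy, hyw⟩)
      (Or.inr ⟨hU2, u, hu, huw⟩)
  have hcyc : ∀ p q r, ℓ p q = ℓ a b → ℓ q r = ℓ a b → O p q → O q r → ¬ O r p :=
    fun p q r h3 h4 hpq hqr => hO.asymm (hO.trans hpq hqr (by omega)).1
  have A := Represents.triangle hℓ hS h1 h2 hU1 hu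
  have B := Represents.triangle hℓ hS (a := b) (b := c) (c := a) (by omega) (by omega) hU2 hv
  have C := Represents.triangle hℓ hS (a := c) (b := a) (c := b) (by omega) (by omega) hU3 hy
  have e1 := hℓ a b
  have e2 := hℓ b c
  have e3 := hℓ a c
  rcases A with A | A
  · rcases C with C | C
    · rcases B with B | B
      · have := (Represents.cross hℓ hS hU1 hy A).1
        have := (Represents.cross hℓ hS hU2 hu B).1
        exact hcyc y u v (by omega) (by omega) (hyw u A) (huw v B) (hvw y C)
      · exact hO.asymm (hyw v B) (hvw y C)
    · exact hO.asymm (hyw u A) (huw y C)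
  · rcases B with B | B
    · exact hO.asymm (huw v B) (hvw u A)
    · rcases C with C | C
      · exact hO.asymm (hyw v B) (hvw y C)
      · have := (Represents.cross hℓ hS hU3 hv A).1
        have := (Represents.cross hℓ hS hU2 hu C).1
        exact hcyc v u y (by omega) (by omega) (hvw u A) (huw y C) (hyw v B)

/-- Every forcing-closed partial orientation extends to a TTO, provided that there is a TTO
at all. -/
theorem IsPartialTTO.exists_extension [Finite V] (hℓ : ∀ a b, ℓ a b = ℓ b a)
    (hS : IsPartialTTO ℓ S) (hO : IsWeightTTO ℓ O) :
    ∃ O', IsWeightTTO ℓ O' ∧ ∀ a b, S a b → O' a b := by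
  refine ⟨modified ℓ S O, ⟨fun h => h.elim hS.pos fun h => h.1.1, modified_asymm hS hO,
    modified_total hℓ hS hO, fun {a b c} hab hbc h => ?_⟩, fun a b h => Or.inl h⟩
  have h1 := modified_not_forbidden hℓ hS hO hab hbc h
  have hpos : 0 < ℓ b c := hbc.elim hS.pos fun h => h.1.1
  refine ⟨(modified_total hℓ hS hO (hpos.trans_le h1)).resolve_right fun hca => ?_, h1⟩
  have e1 := hℓ a b
  have e2 := hℓ b c
  have e3 := hℓ a c
  have h2 := modified_not_forbidden hℓ hS hO hbc hca (by omega)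
  exact modified_triangle hℓ hS hO (by omega) (by omega) hab hbc hca

end

/-! ### Program verification on the random access machine -/

namespace RAM

/-- Started in `s`, the program `p` halts without overflow after a time `t` in a configuration `s'`
with `Q t s'`. -/
def Runs (B : ℕ) (p : Program) (s : State) (Q : ℕ → State → Prop) : Prop :=
  ∃ t s', Exec B p s t s' ∧ Q t s'

theorem Runs.mono {B : ℕ} {p : Program} {s : State} {Q Q' : ℕ → State → Prop}
    (h : Runs B p s Q) (hQ : ∀ t s', Q t s' → Q' t s') : Runs B p s Q' :=
  let ⟨t, s', he, hq⟩ := h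
  ⟨t, s', he, hQ t s' hq⟩

theorem Runs.skip {B : ℕ} {s : State} {Q : ℕ → State → Prop} (h : Q 1 s) :
    Runs B .skip s Q :=
  ⟨1, s, .skip s, h⟩

theorem Runs.assign {B x : ℕ} {e : Expr} {s : State} {Q : ℕ → State → Prop} (hf : e.Fits B s)
    (h : Q (e.cost + 1) (s.setReg x (e.eval s))) : Runs B (.assign x e) s Q :=
  ⟨_, _, .assign s x e hf, h⟩

theorem Runs.write {B a : ℕ} {i e : Expr} {s : State} {Q : ℕ → State → Prop} (hi : i.Fits B s)
    (he : e.Fits B s) (h : Q (i.cost + e.cost + 1) (s.setArr a (i.eval s) (e.eval s))) :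
    Runs B (.write a i e) s Q :=
  ⟨_, _, .write s a i e hi he, h⟩

theorem Runs.seq {B : ℕ} {p q : Program} {s : State} {Q : ℕ → State → Prop}
    (h : Runs B p s fun t s' => Runs B q s' fun t' s'' => Q (t + t') s'') :
    Runs B (.seq p q) s Q :=
  let ⟨_, _, hp, _, _, hq, h⟩ := h
  ⟨_, _, .seq hp hq, h⟩

theorem Runs.cond {B : ℕ} {e : Expr} {p q : Program} {s : State} {Q : ℕ → State → Prop}
    (hf : e.Fits B s)
    (hp : e.eval s ≠ 0 → Runs B p s fun t s' => Q (e.cost + 1 + t) s')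
    (hq : e.eval s = 0 → Runs B q s fun t s' => Q (e.cost + 1 + t) s') :
    Runs B (.cond e p q) s Q := by
  by_cases he : e.eval s = 0
  · obtain ⟨t, s', hx, h⟩ := hq he
    exact ⟨_, _, .cond_false hf he hx, h⟩
  · obtain ⟨t, s', hx, h⟩ := hp he
    exact ⟨_, _, .cond_true hf he hx, h⟩

/-- The loop rule: `I k t s` is an invariant that relates a variant `k`, which has to decrease, the
elapsed time `t` and the configuration `s`. -/
theorem Runs.loop {B : ℕ} {e : Expr} {p : Program} {Q : ℕ → State → Prop}
    (I : ℕ → ℕ → State → Prop) (hf : ∀ k t s, I k t s → e.Fits B s)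
    (hexit : ∀ k t s, I k t s → e.eval s = 0 → Q (t + (e.cost + 1)) s)
    (hstep : ∀ k t s, I k t s → e.eval s ≠ 0 →
      Runs B p s fun t' s' => ∃ k' < k, I k' (t + (e.cost + 1 + t')) s')
    {k : ℕ} {s : State} (h : I k 0 s) : Runs B (.loop e p) s Q := by
  have main : ∀ k t s, I k t s → Runs B (.loop e p) s fun t' s' => Q (t + t') s' := by
    intro k
    induction k using Nat.strong_induction_on with
    | _ k ih =>
      intro t s h
      by_cases he : e.eval s = 0
      · exact ⟨_, _, .loop_false (hf k t s h) he, hexit k t s h he⟩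
      · obtain ⟨t1, s1, hp, k', hk', h1⟩ := hstep k t s h he
        obtain ⟨t2, s2, hl, h2⟩ := ih k' hk' _ _ h1
        refine ⟨_, _, .loop_true (hf k t s h) he hp hl, ?_⟩
        simpa [add_assoc] using h2
  simpa using main k 0 s h

theorem State.setReg_reg (s : State) (x v y : ℕ) :
    (s.setReg x v).reg y = if y = x then v else s.reg y :=
  Function.update_apply _ _ _ _

theorem State.setReg_arr (s : State) (x v : ℕ) : (s.setReg x v).arr = s.arr := rfl

theorem State.setArr_reg (s : State) (a i v : ℕ) : (s.setArr a i v).reg = s.reg := rfl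

theorem State.setArr_arr (s : State) (a i v b j : ℕ) :
    (s.setArr a i v).arr b j = if b = a ∧ j = i then v else s.arr b j := by
  simp only [State.setArr, Function.update_apply]
  split_ifs <;> simp_all

/-- The expression `e` can be evaluated without overflow, and its value is at most `k`. -/
def Expr.Bdd (B : ℕ) (s : State) (k : ℕ) (e : Expr) : Prop :=
  e.Fits B s ∧ e.eval s ≤ k

section

variable {B k l : ℕ} {s : State} {e f : Expr}

theorem Expr.Bdd.lit {c : ℕ} (h : c ≤ B) : (Expr.lit c).Bdd B s c :=
  ⟨h, le_rfl⟩

theorem Expr.Bdd.read {a : ℕ} (he : e.Fits B s) (h : s.arr a (e.eval s) ≤ k) (hk : k ≤ B) :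
    (Expr.read a e).Bdd B s k :=
  ⟨⟨he, h.trans hk⟩, h⟩

theorem Expr.Bdd.add (he : e.Bdd B s k) (hf : f.Bdd B s l) (h : k + l ≤ B) :
    (e.add f).Bdd B s (k + l) :=
  have h' : e.eval s + f.eval s ≤ k + l := Nat.add_le_add he.2 hf.2
  ⟨⟨he.1, hf.1, h'.trans h⟩, h'⟩

theorem Expr.Bdd.mul (he : e.Bdd B s k) (hf : f.Bdd B s l) (h : k * l ≤ B) :
    (e.mul f).Bdd B s (k * l) :=
  have h' : e.eval s * f.eval s ≤ k * l := Nat.mul_le_mul he.2 hf.2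
  ⟨⟨he.1, hf.1, h'.trans h⟩, h'⟩

theorem Expr.Bdd.sub (he : e.Bdd B s k) (hf : f.Fits B s) : (e.sub f).Bdd B s k :=
  ⟨⟨he.1, hf⟩, (Nat.sub_le _ _).trans he.2⟩

theorem Expr.Bdd.lt (he : e.Fits B s) (hf : f.Fits B s) (h : 1 ≤ B) : (e.lt f).Bdd B s 1 :=
  ⟨⟨he, hf, h⟩, by simp only [Expr.eval]; split_ifs <;> omega⟩

theorem Expr.Bdd.eq (he : e.Fits B s) (hf : f.Fits B s) (h : 1 ≤ B) : (e.eq f).Bdd B s 1 :=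
  ⟨⟨he, hf, h⟩, by simp only [Expr.eval]; split_ifs <;> omega⟩

end

end RAM

/-! ### Propagation of an arc -/

section

variable {n : ℕ}

/-- The arcs committed earlier, together with the arcs found by a propagation. -/
def Marked (S Q : List (Fin n × Fin n)) (a b : Fin n) : Prop :=
  (a, b) ∈ S ∨ (a, b) ∈ Q

/-- The state of the propagation of the arc `x₀` on top of the committed arcs `S`: the list `Q` of
the arcs found, all of them forced by `S` and `x₀`, and a flag `c` that is set to `1` when two
opposite arcs have been found. -/
structure Propagation (ℓ : Fin n → Fin n → ℕ) (S : List (Fin n × Fin n)) (x₀ : Fin n × Fin n)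
    (Q : List (Fin n × Fin n)) (c : ℕ) : Prop where
  nodup : Q.Nodup
  pos : ∀ x ∈ Q, 0 < ℓ x.1 x.2
  disjoint : ∀ x ∈ Q, x ∉ S
  start : x₀ ∈ Q
  flag_le : c ≤ 1
  sound : ∀ T : Fin n → Fin n → Prop, ForcingClosed ℓ T → (∀ x ∈ S, T x.1 x.2) → T x₀.1 x₀.2 →
    ∀ x ∈ Q, T x.1 x.2
  conflict : c ≠ 0 → ∀ T : Fin n → Fin n → Prop, ForcingClosed ℓ T → (∀ x ∈ S, T x.1 x.2) →
    T x₀.1 x₀.2 → ∃ p q, T p q ∧ T q p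
  consistent : c = 0 → ∀ p q, Marked S Q p q → ¬ Marked S Q q p

/-- All arcs forced by an arc `x`, on its own or together with a committed arc or an arc of `R`,
have been found. -/
def Expanded (ℓ : Fin n → Fin n → ℕ) (S R Q : List (Fin n × Fin n)) (x : Fin n × Fin n)
    (w : Fin n) : Prop :=
  (ForcesIn ℓ (Marked S R) x.1 x.2 w → Marked S Q w x.2) ∧
    (ForcesOut ℓ (Marked S R) x.1 x.2 w → Marked S Q x.1 w)

variable {ℓ : Fin n → Fin n → ℕ} {S R Q Q' : List (Fin n × Fin n)} {x x₀ : Fin n × Fin n} {c : ℕ}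

theorem Marked.mono (h : ∀ x ∈ Q, x ∈ Q') {a b : Fin n} (hm : Marked S Q a b) :
    Marked S Q' a b :=
  hm.imp_right (h _)

theorem Marked.append_singleton {a b : Fin n} :
    Marked S (Q ++ [x]) a b ↔ Marked S Q a b ∨ (a, b) = x := by
  simp [Marked, or_assoc]

theorem ForcesIn.mono {V : Type*} {ℓ : V → V → ℕ} {S T : V → V → Prop}
    (h : ∀ a b, S a b → T a b) {a b w : V} (hf : ForcesIn ℓ S a b w) : ForcesIn ℓ T a b w :=
  hf.imp_right fun ⟨h1, h2, h3⟩ => ⟨h1, h2, h _ _ h3⟩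

theorem ForcesOut.mono {V : Type*} {ℓ : V → V → ℕ} {S T : V → V → Prop}
    (h : ∀ a b, S a b → T a b) {a b w : V} (hf : ForcesOut ℓ S a b w) : ForcesOut ℓ T a b w :=
  hf.imp_right fun ⟨h1, h2, h3⟩ => ⟨h1, h2, h _ _ h3⟩

theorem Expanded.mono {w : Fin n} (h : ∀ x ∈ Q, x ∈ Q') (he : Expanded ℓ S R Q x w) :
    Expanded ℓ S R Q' x w :=
  ⟨fun hf => (he.1 hf).mono h, fun hf => (he.2 hf).mono h⟩

theorem Expanded.anti {R' : List (Fin n × Fin n)} {w : Fin n}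
    (h : ∀ x ∈ R, x ∈ R') (he : Expanded ℓ S R' Q x w) : Expanded ℓ S R Q x w :=
  ⟨fun hf => he.1 (hf.mono fun _ _ hm => hm.mono h),
    fun hf => he.2 (hf.mono fun _ _ hm => hm.mono h)⟩

theorem Propagation.marked_sound (hP : Propagation ℓ S x₀ Q c) {T : Fin n → Fin n → Prop}
    (hT : ForcingClosed ℓ T) (hS : ∀ x ∈ S, T x.1 x.2) (h0 : T x₀.1 x₀.2) {a b : Fin n}
    (h : Marked S Q a b) : T a b :=
  h.elim (hS _) (hP.sound T hT hS h0 _)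

/-- A new arc that is forced is appended to the list; the flag is set if the opposite arc is
already there. -/
theorem Propagation.push (hP : Propagation ℓ S x₀ Q c) {p q : Fin n} (hpos : 0 < ℓ p q)
    (hne : p ≠ q) (hnew : ¬ Marked S Q p q)
    (hforced : ∀ T : Fin n → Fin n → Prop, ForcingClosed ℓ T → (∀ a b, Marked S Q a b → T a b) →
      T p q) {c' : ℕ} (hc1 : Marked S Q q p → c' = 1) (hc0 : ¬ Marked S Q q p → c' = c) :
    Propagation ℓ S x₀ (Q ++ [(p, q)]) c' := by
  have hforced' : ∀ T : Fin n → Fin n → Prop, ForcingClosed ℓ T → (∀ x ∈ S, T x.1 x.2) →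
      T x₀.1 x₀.2 → T p q := fun T hT hS h0 =>
    hforced T hT fun _ _ => hP.marked_sound hT hS h0
  constructor
  · rw [List.nodup_append]
    refine ⟨hP.nodup, by simp, ?_⟩
    rintro a ha b hb rfl
    rw [List.mem_singleton] at hb
    exact hnew (Or.inr (hb ▸ ha))
  · intro x hx
    rcases List.mem_append.1 hx with hx | hx
    · exact hP.pos x hx
    · rw [List.mem_singleton] at hx
      exact hx ▸ hpos
  · intro x hx
    rcases List.mem_append.1 hx with hx | hx
    · exact hP.disjoint x hx
    · rw [List.mem_singleton] at hx
      exact fun h => hnew (Or.inl (hx ▸ h))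
  · exact List.mem_append_left _ hP.start
  · by_cases h : Marked S Q q p
    · rw [hc1 h]
    · rw [hc0 h]
      exact hP.flag_le
  · intro T hT hS h0 x hx
    rcases List.mem_append.1 hx with hx | hx
    · exact hP.sound T hT hS h0 x hx
    · rw [List.mem_singleton] at hx
      subst hx
      exact hforced' T hT hS h0
  · intro hc T hT hS h0
    by_cases h : Marked S Q q p
    · exact ⟨p, q, hforced' T hT hS h0, hP.marked_sound hT hS h0 h⟩
    · exact hP.conflict (hc0 h ▸ hc) T hT hS h0
  · intro hc a b hab hba
    have h : ¬ Marked S Q q p := fun h => by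
      rw [hc1 h] at hc
      exact one_ne_zero hc
    have hcons := hP.consistent (hc0 h ▸ hc)
    rw [Marked.append_singleton] at hab hba
    rcases hab with hab | hab <;> rcases hba with hba | hba
    · exact hcons a b hab hba
    · rw [Prod.mk.injEq] at hba
      exact h (hba.1 ▸ hba.2 ▸ hab)
    · rw [Prod.mk.injEq] at hab
      exact h (hab.1 ▸ hab.2 ▸ hba)
    · rw [Prod.mk.injEq] at hab hba
      exact hne (hab.1.symm.trans hba.2)

/-- A propagation that has finished without conflict extends the committed arcs to a
forcing-closed partial orientation. -/
theorem Propagation.isPartialTTO (hℓ : ∀ a b, ℓ a b = ℓ b a)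
    (hS : IsPartialTTO ℓ fun a b => (a, b) ∈ S) (hP : Propagation ℓ S x₀ Q 0)
    (hQ : ∀ x ∈ Q, ∀ w, Expanded ℓ S Q Q x w) :
    IsPartialTTO ℓ fun a b => (a, b) ∈ S ++ Q := by
  have hmem : ∀ a b, (a, b) ∈ S ++ Q ↔ Marked S Q a b := fun a b => List.mem_append
  simp only [hmem]
  refine ⟨fun {a b} h => h.elim hS.pos (hP.pos (a, b)), fun {a b} => hP.consistent rfl a b, ?_⟩
  rintro a b (hab | hab) w
  · have e1 := hℓ a b
    have e2 := hℓ a w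
    have e3 := hℓ b w
    constructor
    · rintro (h | ⟨h1, h2, hw | hw⟩)
      · exact Or.inl ((hS.closed hab w).1 (Or.inl h))
      · exact Or.inl ((hS.closed hab w).1 (Or.inr ⟨h1, h2, hw⟩))
      · exact (hQ _ hw b).2 (Or.inr ⟨by dsimp only; omega, by dsimp only; omega, Or.inl hab⟩)
    · rintro (h | ⟨h1, h2, hw | hw⟩)
      · exact Or.inl ((hS.closed hab w).2 (Or.inl h))
      · exact Or.inl ((hS.closed hab w).2 (Or.inr ⟨h1, h2, hw⟩))
      · exact (hQ _ hw a).1 (Or.inr ⟨by dsimp only; omega, by dsimp only; omega, Or.inl hab⟩)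
  · exact hQ _ hab w

theorem Propagation.singleton (hS : IsPartialTTO ℓ fun a b => (a, b) ∈ S) {u v : Fin n}
    (hloop : ∀ a, ℓ a a = 0) (huv : Undecided ℓ (fun a b => (a, b) ∈ S) u v) :
    Propagation ℓ S (u, v) [(u, v)] 0 := by
  refine ⟨by simp, by simpa using huv.1, by simpa using huv.2.1, by simp, by simp,
    fun T _ _ h0 x hx => ?_, fun h => absurd rfl h, fun _ p q hpq hqp => ?_⟩
  · rw [List.mem_singleton] at hx
    exact hx ▸ h0
  · simp only [Marked, List.mem_singleton, Prod.mk.injEq] at hpq hqp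
    rcases hpq with h | ⟨rfl, rfl⟩ <;> rcases hqp with h' | ⟨h1, h2⟩
    · exact hS.asymm h h'
    · subst h1 h2
      exact huv.2.2 h
    · exact huv.2.2 h'
    · subst h1
      have := huv.1
      rw [hloop] at this
      exact lt_irrefl 0 this

theorem List.Nodup.length_le_mul_self (h : Q.Nodup) : Q.length ≤ n * n := by
  simpa using h.length_le_card

/-- When the arc `y` is expanded later than those of `R`, it need not be looked at again in the
expansion of the latter: two consecutive arcs of a monolabel triangle are seen from both. -/
theorem Expanded.snoc (hℓ : ∀ a b, ℓ a b = ℓ b a) {y : Fin n × Fin n}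
    (hR : ∀ x ∈ R, ∀ w, Expanded ℓ S R Q x w) (hRQ : ∀ x ∈ R, x ∈ Q) (hyQ : y ∈ Q)
    (hQ : ∀ x ∈ Q, x ∈ Q') (hy : ∀ w, Expanded ℓ S Q Q' y w) :
    ∀ x ∈ R ++ [y], ∀ w, Expanded ℓ S (R ++ [y]) Q' x w := by
  have hsub : ∀ x ∈ R ++ [y], x ∈ Q := by
    intro x hx
    rcases List.mem_append.1 hx with hx | hx
    · exact hRQ x hx
    · rw [List.mem_singleton] at hx
      exact hx ▸ hyQ
  intro x hx' w
  rcases List.mem_append.1 hx' with hx | hx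
  · obtain ⟨a, b⟩ := x
    have e1 := hℓ a b
    have e2 := hℓ a w
    have e3 := hℓ b w
    have ho := (hR _ hx w).mono hQ
    constructor
    · rintro (h | ⟨h1, h2, h3⟩)
      · exact ho.1 (Or.inl h)
      · rcases Marked.append_singleton.1 h3 with h3 | rfl
        · exact ho.1 (Or.inr ⟨h1, h2, h3⟩)
        · dsimp only at h1 h2
          exact (hy b).2 (Or.inr ⟨by dsimp only; omega, by dsimp only; omega, Or.inr (hRQ _ hx)⟩)
    · rintro (h | ⟨h1, h2, h3⟩)
      · exact ho.2 (Or.inl h)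
      · rcases Marked.append_singleton.1 h3 with h3 | rfl
        · exact ho.2 (Or.inr ⟨h1, h2, h3⟩)
        · dsimp only at h1 h2
          exact (hy a).1 (Or.inr ⟨by dsimp only; omega, by dsimp only; omega, Or.inr (hRQ _ hx)⟩)
  · rw [List.mem_singleton] at hx
    subst hx
    exact (hy w).anti hsub

end

/-! ### The program -/

namespace TTOProgram

open RAM

/-!
The registers `0` and `1` hold `n` and `m`, register `2` the index of the current edge of the input,
register `3` is set when there is no TTO, register `4` holds the number of the current propagation,
`5`, `6` and `7` the arc that is expanded and a third vertex, `8` and `9` an arc or an edge, and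
`10` is a counter. The arrays `0`, `1` and `2` hold the input, `3` the matrix of weights and `4` the
matrix of committed arcs. For the two propagations, the array `5` marks the arcs found, `6` and `7`
hold the queues of the tails and heads of these arcs, and cell `σ` of the arrays `8`, `9` and `10`
holds the number of arcs expanded, the number of arcs found, and the conflict flag.
-/

/-- The cell of a pair of vertices in the matrices. -/
def pair (p q : Expr) : Expr := .add (.mul p (.reg 0)) q

/-- The label plus one of an edge, and `0` for a non-edge. -/
def weight (p q : Expr) : Expr := .read 3 (pair p q)

/-- The arrays of the two propagations are interleaved; register `4` holds the number `0` or `1`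
of the current one. -/
def sided (e : Expr) : Expr := .add (.mul (.lit 2) e) (.reg 4)

/-- A cell of the array `5` that holds this number belongs to an arc found by the current
propagation; the stamps of earlier edges need not be erased. -/
def stamp : Expr := .add (.reg 2) (.lit 1)

/-- The test whether an arc is committed or has been found by the current propagation. -/
def marked (p q : Expr) : Expr :=
  .add (.read 4 (pair p q)) (.eq (.read 5 (sided (pair p q))) stamp)

/-- The test for `≤`. -/
def le (e f : Expr) : Expr := .lt e (.add f (.lit 1))

/-- The test for `ForcesIn`. -/
def forcesIn (a b w : Expr) : Expr :=
  .add (.mul (le (weight a b) (weight b w)) (.lt (weight a w) (weight b w)))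
    (.mul (.mul (.eq (weight a w) (weight a b)) (.eq (weight b w) (weight a b))) (marked w a))

/-- The test for `ForcesOut`. -/
def forcesOut (a b w : Expr) : Expr :=
  .add (.mul (.mul (.lt (.lit 0) (weight a w)) (le (weight a w) (weight a b)))
      (.lt (weight b w) (weight a b)))
    (.mul (.mul (.eq (weight a w) (weight a b)) (.eq (weight b w) (weight a b))) (marked b w))

/-- Append the arc held by the registers `8` and `9` to the queue of the current propagation, and
set the conflict flag if the opposite arc is already there. -/
def append : Program :=
  .seq (.cond (marked (.reg 9) (.reg 8)) (.write 10 (.reg 4) (.lit 1)) .skip) <|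
  .seq (.write 5 (sided (pair (.reg 8) (.reg 9))) stamp) <|
  .seq (.write 6 (sided (.read 9 (.reg 4))) (.reg 8)) <|
  .seq (.write 7 (sided (.read 9 (.reg 4))) (.reg 9)) <|
  .write 9 (.reg 4) (.add (.read 9 (.reg 4)) (.lit 1))

/-- Append an arc unless it is committed or found already. -/
def push : Program :=
  .cond (marked (.reg 8) (.reg 9)) .skip append

/-- Push the arcs `w → b` and `a → w` if they are forced by `a → b`, where the registers `5`, `6`
and `7` hold `a`, `b` and `w`. -/
def expandVertex : Program :=
  .seq (.cond (forcesIn (.reg 5) (.reg 6) (.reg 7))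
    (.seq (.assign 8 (.reg 7)) (.seq (.assign 9 (.reg 6)) push)) .skip) <|
  .seq (.cond (forcesOut (.reg 5) (.reg 6) (.reg 7))
    (.seq (.assign 8 (.reg 5)) (.seq (.assign 9 (.reg 7)) push)) .skip) <|
  .assign 7 (.add (.reg 7) (.lit 1))

/-- Push all arcs forced by the first arc of the queue that has not been expanded. -/
def expand : Program :=
  .seq (.assign 5 (.read 6 (sided (.read 8 (.reg 4))))) <|
  .seq (.assign 6 (.read 7 (sided (.read 8 (.reg 4))))) <|
  .seq (.write 8 (.reg 4) (.add (.read 8 (.reg 4)) (.lit 1))) <|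
  .seq (.assign 7 (.lit 0)) <|
  .loop (.lt (.reg 7) (.reg 0)) expandVertex

/-! ### Correctness of the expansion of an arc -/

variable {n : ℕ} {ℓ : Fin n → Fin n → ℕ} {S Q : List (Fin n × Fin n)} {B M i σ h c J : ℕ}
  {x₀ : Fin n × Fin n} {s s' : State}

/-- What the configuration holds throughout the treatment of the `i`-th edge of the input: the
weights and the committed arcs `S`. -/
structure Env (ℓ : Fin n → Fin n → ℕ) (S : List (Fin n × Fin n)) (i : ℕ) (s : State) : Prop where
  size : s.reg 0 = n
  index : s.reg 2 = i
  weight : ∀ a b : Fin n, s.arr 3 (a * n + b) = ℓ a b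
  committed : ∀ a b : Fin n, s.arr 4 (a * n + b) = if (a, b) ∈ S then 1 else 0
  stamp_le : ∀ x, s.arr 5 x ≤ i + 1

/-- What the configuration holds for the propagation `σ`: the queue `Q`, of which `h` arcs have been
expanded, and the conflict flag `c`. -/
structure Side (i : ℕ) (σ : ℕ) (Q : List (Fin n × Fin n)) (h c : ℕ) (s : State) : Prop where
  head : s.arr 8 σ = h
  tail : s.arr 9 σ = Q.length
  flag : s.arr 10 σ = c
  fst : ∀ (j : ℕ) (hj : j < Q.length), s.arr 6 (2 * j + σ) = Q[j].1
  snd : ∀ (j : ℕ) (hj : j < Q.length), s.arr 7 (2 * j + σ) = Q[j].2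
  mark : ∀ a b : Fin n, s.arr 5 (2 * (a * n + b) + σ) = i + 1 ↔ (a, b) ∈ Q

/-- The effect on the rest of the configuration of a part of the program that works on the
propagation `σ`. -/
structure Frame (n i σ : ℕ) (s s' : State) : Prop where
  reg : ∀ x < 5, s'.reg x = s.reg x
  arr : ∀ a < 5, s'.arr a = s.arr a
  stamp_le : (∀ x, s.arr 5 x ≤ i + 1) → ∀ x, s'.arr 5 x ≤ i + 1
  other : ∀ τ < 2, τ ≠ σ → ∀ (Q : List (Fin n × Fin n)) (h c : ℕ), Side i τ Q h c s →
    Side i τ Q h c s'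

/-- The word size suffices for the numbers that occur: the interleaved matrix has `2 n ^ 2` cells,
and the numbers stored are weights and stamps. -/
structure Fit (B : ℕ) (ℓ : Fin n → Fin n → ℕ) (i : ℕ) : Prop where
  size : 4 * (n * n) + 10 ≤ B
  weight : ∀ a b, ℓ a b + 1 ≤ B
  index : i + 1 ≤ B

theorem Frame.refl (n i σ : ℕ) (s : State) : Frame n i σ s s :=
  ⟨fun _ _ => rfl, fun _ _ => rfl, id, fun _ _ _ _ _ _ => id⟩

theorem Frame.trans {s₁ s₂ s₃ : State} (h : Frame n i σ s₁ s₂) (h' : Frame n i σ s₂ s₃) :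
    Frame n i σ s₁ s₃ :=
  ⟨fun x hx => (h'.reg x hx).trans (h.reg x hx), fun a ha => (h'.arr a ha).trans (h.arr a ha),
    fun hs => h'.stamp_le (h.stamp_le hs),
    fun τ hτ hne Q h₁ c hs => h'.other τ hτ hne Q h₁ c (h.other τ hτ hne Q h₁ c hs)⟩

theorem Env.frame (he : Env ℓ S i s) (hf : Frame n i σ s s') : Env ℓ S i s' :=
  ⟨(hf.reg 0 (by omega)).trans he.size, (hf.reg 2 (by omega)).trans he.index,
    fun a b => by rw [hf.arr 3 (by omega)]; exact he.weight a b,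
    fun a b => by rw [hf.arr 4 (by omega)]; exact he.committed a b, hf.stamp_le he.stamp_le⟩

/-- The registers from `5` on are not part of the frame. -/
theorem Frame.setReg (hf : Frame n i σ s s') {x v : ℕ} (hx : 5 ≤ x) :
    Frame n i σ s (s'.setReg x v) := by
  refine ⟨fun y hy => ?_, hf.arr, hf.stamp_le, fun τ hτ hne Q h c hs => ?_⟩
  · rw [State.setReg_reg, if_neg (by omega)]
    exact hf.reg y hy
  · have := hf.other τ hτ hne Q h c hs
    exact ⟨this.head, this.tail, this.flag, this.fst, this.snd, this.mark⟩

theorem Side.setReg (hs : Side i σ Q h c s) (x v : ℕ) : Side i σ Q h c (s.setReg x v) :=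
  ⟨hs.head, hs.tail, hs.flag, hs.fst, hs.snd, hs.mark⟩

theorem pair_lt (a b : Fin n) : (a : ℕ) * n + b < n * n :=
  calc (a : ℕ) * n + b < a * n + n := by omega
    _ = (a + 1) * n := by ring
    _ ≤ n * n := Nat.mul_le_mul_right n a.2

theorem pair_inj {a b p q : Fin n} (h : (a : ℕ) * n + b = p * n + q) : a = p ∧ b = q := by
  have hn : 0 < n := a.pos
  have h1 := congrArg (· / n) h
  have h2 := congrArg (· % n) h
  simp only [Nat.mul_comm _ n, Nat.mul_add_div hn, Nat.mul_add_mod, Nat.mod_eq_of_lt b.2,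
    Nat.mod_eq_of_lt q.2, Nat.div_eq_of_lt b.2, Nat.div_eq_of_lt q.2, add_zero] at h1 h2
  exact ⟨Fin.ext h1, Fin.ext h2⟩

/-- The expression `e` can be evaluated without overflow, and its value is the vertex `a`. -/
def IsVertex (B : ℕ) (s : State) (e : Expr) (a : Fin n) : Prop :=
  e.Fits B s ∧ e.eval s = a

theorem isVertex_reg (hB : 4 * (n * n) + 10 ≤ B) {x : ℕ} {a : Fin n} (h : s.reg x = a) :
    IsVertex B s (.reg x) a := by
  refine ⟨?_, h⟩
  have := pair_lt a a
  have := Nat.le_mul_of_pos_right (a : ℕ) a.pos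
  simp only [Expr.Fits, h]
  omega

section

variable {p q r : Expr} {a b w : Fin n}

theorem pair_spec (hB : 4 * (n * n) + 10 ≤ B) (he : s.reg 0 = n) (hp : IsVertex B s p a)
    (hq : IsVertex B s q b) : (pair p q).Fits B s ∧ (pair p q).eval s = a * n + b := by
  have h1 := pair_lt a b
  have h2 := Nat.le_mul_self n
  simp only [pair, Expr.Fits, Expr.eval, hp.1, hq.1, hp.2, hq.2, he, true_and, and_true]
  omega

theorem weight_spec (hB : Fit B ℓ i) (he : Env ℓ S i s) (hp : IsVertex B s p a)
    (hq : IsVertex B s q b) : (weight p q).Fits B s ∧ (weight p q).eval s = ℓ a b := by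
  obtain ⟨h1, h2⟩ := pair_spec hB.size he.size hp hq
  have := hB.weight a b
  simp only [weight, Expr.Fits, Expr.eval, h1, h2, he.weight, true_and, and_true]
  omega

theorem sided_pair_spec (hB : Fit B ℓ i) (he : Env ℓ S i s) (hr : s.reg 4 = σ) (hσ : σ < 2)
    (hp : IsVertex B s p a) (hq : IsVertex B s q b) :
    (sided (pair p q)).Fits B s ∧ (sided (pair p q)).eval s = 2 * (a * n + b) + σ := by
  obtain ⟨h1, h2⟩ := pair_spec hB.size he.size hp hq
  have := pair_lt a b
  have h3 := hB.size
  simp only [sided, Expr.Fits, Expr.eval, h1, h2, hr, true_and, and_true]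
  omega

theorem stamp_spec (hB : Fit B ℓ i) (he : Env ℓ S i s) :
    stamp.Fits B s ∧ stamp.eval s = i + 1 := by
  have h3 := hB.index
  simp only [stamp, Expr.Fits, Expr.eval, he.index, and_true]
  omega

theorem marked_spec (hB : Fit B ℓ i) (he : Env ℓ S i s) (hr : s.reg 4 = σ) (hσ : σ < 2)
    (hs : Side i σ Q h c s) (hp : IsVertex B s p a) (hq : IsVertex B s q b) :
    (marked p q).Bdd B s 2 ∧ ((marked p q).eval s ≠ 0 ↔ Marked S Q a b) := by
  obtain ⟨h1, h2⟩ := pair_spec hB.size he.size hp hq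
  obtain ⟨h3, h4⟩ := sided_pair_spec hB he hr hσ hp hq
  obtain ⟨h5, h6⟩ := stamp_spec hB he
  have h7 := hB.size
  have h8 := hB.index
  constructor
  · refine Expr.Bdd.add (k := 1) (l := 1) (.read h1 ?_ (by omega))
      (.eq ⟨h3, (he.stamp_le _).trans h8⟩ h5 (by omega)) (by omega)
    rw [h2, he.committed]
    split_ifs <;> omega
  · simp only [marked, Expr.eval, h2, h4, h6, he.committed, hs.mark, Marked]
    by_cases h9 : (a, b) ∈ S <;> by_cases h10 : (a, b) ∈ Q <;> simp [h9, h10]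

theorem le_bdd {e f : Expr} (he : e.Fits B s) (hf : f.Fits B s) (h : f.eval s + 1 ≤ B) :
    (le e f).Bdd B s 1 :=
  .lt he ⟨hf, show 1 ≤ B by omega, h⟩ (by omega)

theorem forcesIn_spec (hB : Fit B ℓ i) (he : Env ℓ S i s) (hr : s.reg 4 = σ) (hσ : σ < 2)
    (hs : Side i σ Q h c s) (hp : IsVertex B s p a) (hq : IsVertex B s q b)
    (hw : IsVertex B s r w) :
    (forcesIn p q r).Fits B s ∧
      ((forcesIn p q r).eval s ≠ 0 ↔ ForcesIn ℓ (Marked S Q) a b w) := by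
  obtain ⟨f1, v1⟩ := weight_spec hB he hp hq
  obtain ⟨f2, v2⟩ := weight_spec hB he hq hw
  obtain ⟨f3, v3⟩ := weight_spec hB he hp hw
  obtain ⟨f4, v4⟩ := marked_spec hB he hr hσ hs hw hp
  have h7 := hB.size
  constructor
  · exact (Expr.Bdd.add (k := 1 * 1) (l := 1 * 1 * 2)
      (.mul (le_bdd f1 f2 (v2 ▸ hB.weight _ _)) (.lt f3 f2 (by omega)) (by omega))
      (.mul (.mul (.eq f3 f1 (by omega)) (.eq f2 f1 (by omega)) (by omega)) f4 (by omega))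
      (by omega)).1
  · simp only [forcesIn, le, Expr.eval, v1, v2, v3, ForcesIn, ← v4, ne_eq, add_eq_zero,
      mul_eq_zero, not_and_or, not_or, Nat.lt_succ_iff]
    simp [and_assoc]

theorem forcesOut_spec (hB : Fit B ℓ i) (he : Env ℓ S i s) (hr : s.reg 4 = σ) (hσ : σ < 2)
    (hs : Side i σ Q h c s) (hp : IsVertex B s p a) (hq : IsVertex B s q b)
    (hw : IsVertex B s r w) :
    (forcesOut p q r).Fits B s ∧
      ((forcesOut p q r).eval s ≠ 0 ↔ ForcesOut ℓ (Marked S Q) a b w) := by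
  obtain ⟨f1, v1⟩ := weight_spec hB he hp hq
  obtain ⟨f2, v2⟩ := weight_spec hB he hq hw
  obtain ⟨f3, v3⟩ := weight_spec hB he hp hw
  obtain ⟨f4, v4⟩ := marked_spec hB he hr hσ hs hq hw
  have h7 := hB.size
  constructor
  · exact (Expr.Bdd.add (k := 1 * 1 * 1) (l := 1 * 1 * 2)
      (.mul (.mul (.lt (Expr.Bdd.lit (Nat.zero_le B)).1 f3 (by omega))
        (le_bdd f3 f1 (v1 ▸ hB.weight _ _)) (by omega)) (.lt f2 f1 (by omega)) (by omega))
      (.mul (.mul (.eq f3 f1 (by omega)) (.eq f2 f1 (by omega)) (by omega)) f4 (by omega))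
      (by omega)).1
  · simp only [forcesOut, le, Expr.eval, v1, v2, v3, ForcesOut, ← v4, ne_eq, add_eq_zero,
      mul_eq_zero, not_and_or, not_or, Nat.lt_succ_iff]
    simp [and_assoc, Nat.pos_iff_ne_zero]

end

theorem append_spec (hB : Fit B ℓ i) (he : Env ℓ S i s) (hr : s.reg 4 = σ) (hσ : σ < 2)
    (hs : Side i σ Q h c s) (hQ : Q.length ≤ n * n) {p q : Fin n} (hp : s.reg 8 = p)
    (hq : s.reg 9 = q) :
    Runs B append s fun t s' => t ≤ 90 ∧ s'.reg = s.reg ∧ Frame n i σ s s' ∧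
      ∃ c', (Marked S Q q p → c' = 1) ∧ (¬ Marked S Q q p → c' = c) ∧
        Side i σ (Q ++ [(p, q)]) h c' s' := by
  have vp := isVertex_reg hB.size hp
  have vq := isVertex_reg hB.size hq
  obtain ⟨f1, v1⟩ := marked_spec hB he hr hσ hs vq vp
  obtain ⟨f2, v2⟩ := sided_pair_spec hB he hr hσ vp vq
  obtain ⟨f3, v3⟩ := stamp_spec hB he
  have h7 := hB.size
  -- the rest of the program, run with the conflict flag `c'`
  have hrest : ∀ c' s₁, s₁.reg = s.reg → (∀ a ≠ 10, s₁.arr a = s.arr a) →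
      (∀ x, s₁.arr 10 x = if x = σ then c' else s.arr 10 x) →
      Runs B (.seq (.write 5 (sided (pair (.reg 8) (.reg 9))) stamp) <|
        .seq (.write 6 (sided (.read 9 (.reg 4))) (.reg 8)) <|
        .seq (.write 7 (sided (.read 9 (.reg 4))) (.reg 9)) <|
        .write 9 (.reg 4) (.add (.read 9 (.reg 4)) (.lit 1))) s₁ fun t s' =>
        t ≤ 60 ∧ s'.reg = s.reg ∧ Frame n i σ s s' ∧ Side i σ (Q ++ [(p, q)]) h c' s' := by
    intro c' s₁ hreg harr hflag
    have he1 : Env ℓ S i s₁ := by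
      refine ⟨hreg ▸ he.size, hreg ▸ he.index, ?_, ?_, ?_⟩
      · rw [harr 3 (by omega)]; exact he.weight
      · rw [harr 4 (by omega)]; exact he.committed
      · rw [harr 5 (by omega)]; exact he.stamp_le
    have vp := isVertex_reg hB.size (hreg ▸ hp : s₁.reg 8 = p)
    have vq := isVertex_reg hB.size (hreg ▸ hq : s₁.reg 9 = q)
    obtain ⟨f2, v2⟩ := sided_pair_spec hB he1 (hreg ▸ hr) hσ vp vq
    obtain ⟨f3, v3⟩ := stamp_spec hB he1
    have hn := Nat.le_mul_self n
    have h9 : s₁.arr 9 σ = Q.length := by rw [harr 9 (by omega)]; exact hs.tail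
    refine .seq (.write f2 f3 (.seq (.write ?_ ?_ (.seq (.write ?_ ?_ (.write ?_ ?_ ?_))))))
    iterate 6
      simp only [sided, Expr.Fits, Expr.eval, State.setArr_reg, State.setArr_arr, hreg, hr, hp, hq,
        Nat.reduceEqDiff, false_and, if_false, h9]
      omega
    rw [v2, v3]
    simp only [sided, pair, stamp, Expr.cost, Expr.eval, State.setArr_reg, State.setArr_arr, hreg,
      hr, hp, hq, Nat.reduceEqDiff, false_and, if_false, h9]
    refine ⟨by omega, trivial, ⟨fun x _ => by simp only [State.setArr_reg, hreg], fun a ha => ?_,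
      fun hle x => ?_, fun τ hτ hne Q' h' d hs' => ?_⟩, ?_⟩
    · ext x
      rw [← harr a (by omega)]
      simp only [State.setArr_arr]
      rw [if_neg (by omega), if_neg (by omega), if_neg (by omega), if_neg (by omega)]
    · simp only [State.setArr_arr, Nat.reduceEqDiff, false_and, if_false, true_and]
      split_ifs
      · exact le_rfl
      · rw [harr 5 (by omega)]; exact hle x
    · constructor
      · simp only [State.setArr_arr, Nat.reduceEqDiff, false_and, if_false]
        rw [harr 8 (by omega)]; exact hs'.head
      · simp only [State.setArr_arr, true_and, Nat.reduceEqDiff, false_and, if_false, if_neg hne]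
        rw [harr 9 (by omega)]; exact hs'.tail
      · simp only [State.setArr_arr, Nat.reduceEqDiff, false_and, if_false, hflag, if_neg hne]
        exact hs'.flag
      · intro j hj
        simp only [State.setArr_arr, Nat.reduceEqDiff, false_and, if_false, true_and]
        rw [if_neg (by omega), harr 6 (by omega)]; exact hs'.fst j hj
      · intro j hj
        simp only [State.setArr_arr, Nat.reduceEqDiff, false_and, if_false, true_and]
        rw [if_neg (by omega), harr 7 (by omega)]; exact hs'.snd j hj
      · intro a b
        simp only [State.setArr_arr, Nat.reduceEqDiff, false_and, if_false, true_and]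
        rw [if_neg (by omega), harr 5 (by omega)]; exact hs'.mark a b
    · constructor
      · simp only [State.setArr_arr, Nat.reduceEqDiff, false_and, if_false]
        rw [harr 8 (by omega)]; exact hs.head
      · simp [State.setArr_arr]
      · simp [State.setArr_arr, hflag]
      · intro j hj
        simp only [State.setArr_arr, Nat.reduceEqDiff, false_and, if_false, true_and]
        rw [List.length_append, List.length_singleton] at hj
        rcases Nat.lt_succ_iff_lt_or_eq.1 hj with hj | rfl
        · rw [if_neg (by omega), harr 6 (by omega), hs.fst j hj, List.getElem_append_left]
        · simp
      · intro j hj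
        simp only [State.setArr_arr, Nat.reduceEqDiff, false_and, if_false, true_and]
        rw [List.length_append, List.length_singleton] at hj
        rcases Nat.lt_succ_iff_lt_or_eq.1 hj with hj | rfl
        · rw [if_neg (by omega), harr 7 (by omega), hs.snd j hj, List.getElem_append_left]
        · simp
      · intro a b
        simp only [State.setArr_arr, Nat.reduceEqDiff, false_and, if_false, true_and]
        rw [List.mem_append, List.mem_singleton, ← hs.mark, harr 5 (by omega)]
        split_ifs with heq
        · obtain ⟨rfl, rfl⟩ := pair_inj (a := a) (b := b) (p := p) (q := q) (by omega)
          simp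
        · refine (or_iff_left ?_).symm
          rintro h
          rw [Prod.mk.injEq] at h
          exact heq (by rw [h.1, h.2])
  have hσ10 : ∀ x, s.arr 10 x = if x = σ then c else s.arr 10 x := fun x => by
    split_ifs with hx
    · rw [hx, hs.flag]
    · rfl
  have hcost : (marked (.reg 9) (.reg 8)).cost = 21 := rfl
  refine .seq (.cond f1.1 (fun hm => ?_) fun hm => ?_)
  · refine .write (by simp only [Expr.Fits, hr]; omega) (show 1 ≤ B by omega) ?_
    refine (hrest 1 (s.setArr 10 (Expr.eval s (.reg 4)) (Expr.eval s (.lit 1))) rfl ?_ ?_).mono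
      fun t s' ⟨h1, h2, h3, h4⟩ => ⟨?_, h2, h3, 1, ?_, ?_, h4⟩
    · intro a ha
      ext x
      rw [State.setArr_arr, if_neg (by omega)]
    · intro x
      simp [State.setArr_arr, Expr.eval, hr]
    · rw [hcost]; simp only [Expr.cost]; omega
    · exact fun _ => rfl
    · exact fun hno => absurd (v1.1 hm) hno
  · refine .skip ?_
    refine (hrest c _ rfl (fun _ _ => rfl) hσ10).mono
      fun t s' ⟨h1, h2, h3, h4⟩ => ⟨?_, h2, h3, c, ?_, fun _ => rfl, h4⟩
    · rw [hcost]; omega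
    · exact fun hyes => absurd hm (v1.2 hyes)

/-- An arc that is forced is pushed; the propagation remains sound and then contains it. -/
theorem push_spec (hB : Fit B ℓ i) (he : Env ℓ S i s) (hr : s.reg 4 = σ) (hσ : σ < 2)
    (hs : Side i σ Q h c s) (hP : Propagation ℓ S x₀ Q c) {p q : Fin n} (hp : s.reg 8 = p)
    (hq : s.reg 9 = q) (hpos : 0 < ℓ p q) (hne : p ≠ q)
    (hforced : ∀ T : Fin n → Fin n → Prop, ForcingClosed ℓ T → (∀ a b, Marked S Q a b → T a b) →
      T p q) :
    Runs B push s fun t s' => t ≤ 112 ∧ s'.reg = s.reg ∧ Frame n i σ s s' ∧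
      ∃ Q' c', Side i σ Q' h c' s' ∧ Propagation ℓ S x₀ Q' c' ∧ Q <+: Q' ∧ Marked S Q' p q := by
  obtain ⟨f1, v1⟩ := marked_spec hB he hr hσ hs (isVertex_reg hB.size hp) (isVertex_reg hB.size hq)
  have hcost : (marked (.reg 8) (.reg 9)).cost = 21 := rfl
  refine .cond f1.1 (fun hm => .skip ?_) fun hm => ?_
  · exact ⟨by rw [hcost]; omega, rfl, .refl n i σ s, Q, c, hs, hP, List.prefix_refl Q, v1.1 hm⟩
  · have hnew : ¬ Marked S Q p q := fun h => v1.2 h hm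
    refine (append_spec hB he hr hσ hs hP.nodup.length_le_mul_self hp hq).mono ?_
    rintro t s' ⟨h1, h2, h3, c', h4, h5, h6⟩
    exact ⟨by rw [hcost]; omega, h2, h3, _, c', h6, hP.push hpos hne hnew hforced h4 h5,
      List.prefix_append _ _, Marked.append_singleton.2 (Or.inr rfl)⟩

theorem expandVertex_spec (hℓ : ∀ a b, ℓ a b = ℓ b a) (hloop : ∀ a, ℓ a a = 0)
    (hB : Fit B ℓ i) (he : Env ℓ S i s) (hr : s.reg 4 = σ)
    (hσ : σ < 2) (hs : Side i σ Q h c s) (hP : Propagation ℓ S x₀ Q c) {a b w : Fin n}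
    (ha : s.reg 5 = a) (hb : s.reg 6 = b) (hw : s.reg 7 = w) (hab : (a, b) ∈ Q) :
    Runs B expandVertex s fun t s' => t ≤ 450 ∧ s'.reg 5 = a ∧ s'.reg 6 = b ∧ s'.reg 7 = w + 1 ∧
      Frame n i σ s s' ∧
      ∃ Q' c', Side i σ Q' h c' s' ∧ Propagation ℓ S x₀ Q' c' ∧ Q <+: Q' ∧
        Expanded ℓ S Q Q' (a, b) w := by
  have hne : ∀ {p q : Fin n}, 0 < ℓ p q → p ≠ q := by
    rintro p q hpq rfl
    rw [hloop] at hpq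
    exact lt_irrefl 0 hpq
  have hpos : 0 < ℓ a b := hP.pos _ hab
  have hcost1 : (forcesIn (.reg 5) (.reg 6) (.reg 7)).cost = 79 := rfl
  have hcost2 : (forcesOut (.reg 5) (.reg 6) (.reg 7)).cost = 88 := rfl
  obtain ⟨f1, v1⟩ := forcesIn_spec hB he hr hσ hs (isVertex_reg hB.size ha)
    (isVertex_reg hB.size hb) (isVertex_reg hB.size hw)
  have hvertex : ∀ v : Fin n, (v : ℕ) + 1 ≤ B := by
    intro v
    have := Nat.le_mul_self n
    have := hB.size
    omega
  -- the second half of the program, run after the first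
  have hsecond : ∀ (s₁ : State) Q₁ c₁, s₁.reg 5 = a → s₁.reg 6 = b → s₁.reg 7 = w →
      Frame n i σ s s₁ → Side i σ Q₁ h c₁ s₁ → Propagation ℓ S x₀ Q₁ c₁ → Q <+: Q₁ →
      (ForcesIn ℓ (Marked S Q) a b w → Marked S Q₁ w b) →
      Runs B (.seq (.cond (forcesOut (.reg 5) (.reg 6) (.reg 7))
        (.seq (.assign 8 (.reg 5)) (.seq (.assign 9 (.reg 7)) push)) .skip) <|
        .assign 7 (.add (.reg 7) (.lit 1))) s₁ fun t s' =>
        t ≤ 230 ∧ s'.reg 5 = a ∧ s'.reg 6 = b ∧ s'.reg 7 = w + 1 ∧ Frame n i σ s s' ∧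
        ∃ Q' c', Side i σ Q' h c' s' ∧ Propagation ℓ S x₀ Q' c' ∧ Q <+: Q' ∧
          Expanded ℓ S Q Q' (a, b) w := by
    intro s₁ Q₁ c₁ ha hb hw hfr hs₁ hP₁ hpre hin
    have he₁ := he.frame hfr
    have hr₁ : s₁.reg 4 = σ := (hfr.reg 4 (by omega)).trans hr
    obtain ⟨f2, v2⟩ := forcesOut_spec hB he₁ hr₁ hσ hs₁ (isVertex_reg hB.size ha)
      (isVertex_reg hB.size hb) (isVertex_reg hB.size hw)
    refine .seq (.cond f2 (fun hm => ?_) fun hm => .skip ?_)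
    · have hout := v2.1 hm
      refine .seq (.assign (isVertex_reg hB.size ha).1 (.seq (.assign
        (isVertex_reg (a := w) hB.size
          (by rw [State.setReg_reg, if_neg (by omega)]; exact hw)).1 ?_)))
      refine (push_spec (s := (s₁.setReg 8 _).setReg 9 _) (p := a) (q := w) hB
        (he₁.frame (((Frame.refl n i σ s₁).setReg (by omega)).setReg (by omega))) ?_ hσ
        ((hs₁.setReg _ _).setReg _ _) hP₁ ?_ ?_ ?_ ?_ ?_).mono ?_
      · simpa [State.setReg_reg] using hr₁
      · simpa [State.setReg_reg, Expr.eval] using ha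
      · simpa [State.setReg_reg, Expr.eval] using hw
      · rcases hout with h | h <;> omega
      · refine hne ?_
        rcases hout with h | h <;> omega
      · intro T hT hm
        exact (hT (hm a b (Or.inr (hpre.subset hab))) w).2 (hout.mono hm)
      · rintro t s' ⟨h1, h2, h3, Q', c', h4, h5, h6, h7⟩
        refine .assign ?_ ⟨?_, ?_, ?_, ?_, ?_, Q', c', h4.setReg _ _, h5, hpre.trans h6,
          fun hi => (hin hi).mono fun x hx => h6.subset hx, fun _ => h7⟩
        · simp only [Expr.Fits, Expr.eval, h2, State.setReg_reg, Nat.reduceEqDiff, if_false, hw]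
          have := hvertex w
          omega
        · rw [hcost2]; simp only [Expr.cost]; omega
        · simpa [State.setReg_reg, h2] using ha
        · simpa [State.setReg_reg, h2] using hb
        · simp [State.setReg_reg, h2, Expr.eval, hw]
        · exact (((hfr.setReg (by omega)).setReg (by omega)).trans h3).setReg (by omega)
    · refine .assign ?_ ⟨?_, ?_, ?_, ?_, hfr.setReg (by omega), Q₁, c₁, hs₁.setReg _ _, hP₁, hpre,
          hin, fun ho => absurd hm (v2.2 ?_)⟩
      · simp only [Expr.Fits, Expr.eval, hw]
        have := hvertex w
        omega
      · rw [hcost2]; simp only [Expr.cost]; omega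
      · simpa [State.setReg_reg] using ha
      · simpa [State.setReg_reg] using hb
      · simp [State.setReg_reg, Expr.eval, hw]
      · exact ForcesOut.mono (fun _ _ hm => hm.mono fun x hx => hpre.subset hx) ho
  refine .seq (.cond f1 (fun hm => ?_) fun hm => .skip ?_)
  · have hin := v1.1 hm
    refine .seq (.assign (isVertex_reg hB.size hw).1 (.seq (.assign
      (isVertex_reg (a := b) hB.size
        (by rw [State.setReg_reg, if_neg (by omega)]; exact hb)).1 ?_)))
    have e1 := hℓ b w
    have hwb : 0 < ℓ w b := by rcases hin with h | h <;> omega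
    refine (push_spec (s := (s.setReg 8 _).setReg 9 _) (p := w) (q := b) hB
      (he.frame (((Frame.refl n i σ s).setReg (by omega)).setReg (by omega))) ?_ hσ
      ((hs.setReg _ _).setReg _ _) hP ?_ ?_ hwb (hne hwb) ?_).mono ?_
    · simpa [State.setReg_reg] using hr
    · simpa [State.setReg_reg, Expr.eval] using hw
    · simpa [State.setReg_reg, Expr.eval] using hb
    · intro T hT hm
      exact (hT (hm a b (Or.inr hab)) w).1 (hin.mono hm)
    · rintro t s₁ ⟨h1, h2, h3, Q₁, c₁, h4, h5, h6, h7⟩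
      refine (hsecond s₁ Q₁ c₁ (by simpa [State.setReg_reg, h2] using ha)
        (by simpa [State.setReg_reg, h2] using hb) (by simpa [State.setReg_reg, h2] using hw)
        ((((Frame.refl n i σ s).setReg (by omega)).setReg (by omega)).trans h3) h4 h5 h6
        fun _ => h7).mono ?_
      rintro t' s' ⟨g1, g2⟩
      exact ⟨by rw [hcost1]; simp only [Expr.cost]; omega, g2⟩
  · refine (hsecond s Q c ha hb hw (.refl n i σ s) hs hP (List.prefix_refl Q)
      fun hi => absurd hm (v1.2 hi)).mono ?_
    rintro t' s' ⟨g1, g2⟩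
    exact ⟨by rw [hcost1]; omega, g2⟩

/-- The expansion of an arc takes `O(n)` steps, and all arcs forced by it are found. -/
theorem expand_spec (hℓ : ∀ a b, ℓ a b = ℓ b a) (hloop : ∀ a, ℓ a a = 0)
    (hB : Fit B ℓ i) (he : Env ℓ S i s) (hr : s.reg 4 = σ)
    (hσ : σ < 2) (hs : Side i σ Q h c s) (hP : Propagation ℓ S x₀ Q c) (hh : h < Q.length) :
    Runs B expand s fun t s' => t ≤ 460 * n + 60 ∧ Frame n i σ s s' ∧
      ∃ Q' c', Side i σ Q' (h + 1) c' s' ∧ Propagation ℓ S x₀ Q' c' ∧ Q <+: Q' ∧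
        ∀ w, Expanded ℓ S Q Q' Q[h] w := by
  have hlen := hP.nodup.length_le_mul_self
  have h7 := hB.size
  have hn := Nat.le_mul_self n
  set a := Q[h].1 with hadef
  set b := Q[h].2 with hbdef
  have hab : (a, b) ∈ Q := List.getElem_mem hh
  have h6 := hs.fst h hh
  have h6' := hs.snd h hh
  have ha := a.2
  have hb := b.2
  refine .seq (.assign ?_ (.seq (.assign ?_ (.seq (.write ?_ ?_ (.seq (.assign ?_ ?_)))))))
  iterate 5
    simp only [sided, Expr.Fits, Expr.eval, State.setReg_reg, State.setReg_arr, Nat.reduceEqDiff,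
      if_false, hr, hs.head, h6, h6']
    omega
  set s₁ : State := _
  change Runs B _ s₁ _
  have hs₁ : Side i σ Q (h + 1) c s₁ := by
    constructor
    · simp [s₁, State.setReg_arr, State.setArr_arr, State.setReg_reg, Expr.eval, hr, hs.head]
    all_goals simp only [s₁, State.setReg_arr, State.setArr_arr, Nat.reduceEqDiff, false_and,
      if_false]
    · exact hs.tail
    · exact hs.flag
    · exact hs.fst
    · exact hs.snd
    · exact hs.mark
  have hf₁ : Frame n i σ s s₁ := by
    refine Frame.setReg ?_ (by omega)
    refine ⟨fun x hx => ?_, fun a ha => ?_, fun hle x => ?_, fun τ hτ hne Q h c hs => ?_⟩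
    · simp only [State.setArr_reg, State.setReg_reg]
      rw [if_neg (by omega), if_neg (by omega)]
    · ext x
      rw [State.setArr_arr, if_neg (by omega)]
      rfl
    · rw [State.setArr_arr, if_neg (by omega)]
      exact hle x
    · constructor
      · simp only [State.setArr_arr, State.setReg_reg, State.setReg_arr, Expr.eval,
          Nat.reduceEqDiff, if_false, hr, true_and, if_neg hne]
        exact hs.head
      all_goals simp only [State.setReg_arr, State.setArr_arr, Nat.reduceEqDiff, false_and,
        if_false]
      · exact hs.tail
      · exact hs.flag
      · exact hs.fst
      · exact hs.snd
      · exact hs.mark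
  have g5 : s₁.reg 5 = a := by
    simp [s₁, State.setReg_reg, State.setArr_reg, sided, Expr.eval, hr, hs.head, h6, hadef]
  have g6 : s₁.reg 6 = b := by
    simp [s₁, State.setReg_reg, State.setReg_arr, State.setArr_reg, sided, Expr.eval, hr, hs.head,
      h6', hbdef]
  have g7 : s₁.reg 7 = 0 := by
    simp [s₁, State.setReg_reg, Expr.eval]
  clear_value s₁
  -- the vertices below register `7` have been treated
  refine Runs.loop (fun k t s' => ∃ w : ℕ, w ≤ n ∧ k = n - w ∧ t ≤ 454 * w ∧ s'.reg 7 = w ∧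
    s'.reg 5 = a ∧ s'.reg 6 = b ∧ Frame n i σ s s' ∧ ∃ Q' c', Side i σ Q' (h + 1) c' s' ∧
    Propagation ℓ S x₀ Q' c' ∧ Q <+: Q' ∧ ∀ v : Fin n, (v : ℕ) < w → Expanded ℓ S Q Q' (a, b) v)
    ?_ ?_ ?_ (k := n) ⟨0, by omega, by omega, by omega, g7, g5, g6, hf₁, Q, c, hs₁, hP,
      List.prefix_refl Q, fun v hv => absurd hv (Nat.not_lt_zero _)⟩
  · rintro k t s' ⟨w, hw, rfl, -, hw7, -, -, hf, -⟩
    simp only [Expr.Fits, hw7, (he.frame hf).size]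
    omega
  · rintro k t s' ⟨w, hw, rfl, ht, hw7, -, -, hf, Q', c', h1, h2, h3, h4⟩ hexit
    have hwn : w = n := by
      simp only [Expr.eval, hw7, (he.frame hf).size] at hexit
      split_ifs at hexit
      omega
    subst hwn
    refine ⟨?_, hf, Q', c', h1, h2, h3, fun v => h4 v v.2⟩
    simp only [Expr.cost, sided]
    omega
  · rintro k t s' ⟨w, hw, rfl, ht, hw7, ha5, hb6, hf, Q', c', h1, h2, h3, h4⟩ hexit
    have hwn : w < n := by
      simp only [Expr.eval, hw7, (he.frame hf).size] at hexit
      split_ifs at hexit <;> omega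
    refine (expandVertex_spec (w := ⟨w, hwn⟩) hℓ hloop hB (he.frame hf)
      ((hf.reg 4 (by omega)).trans hr) hσ h1 h2 ha5 hb6 hw7 (h3.subset hab)).mono ?_
    rintro t' s'' ⟨k1, k2, k3, k4, k5, Q'', c'', k6, k7, k8, k9⟩
    refine ⟨n - (w + 1), by omega, w + 1, hwn, rfl, ?_, k4, k2, k3, hf.trans k5, Q'', c'', k6, k7,
      h3.trans k8, fun v hv => ?_⟩
    · simp only [Expr.cost]
      omega
    · rcases Nat.lt_succ_iff_lt_or_eq.1 hv with hv | hv
      · exact (h4 v hv).mono fun x hx => k8.subset hx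
      · have hv' : v = ⟨w, hwn⟩ := Fin.ext hv
        rw [hv']
        exact k9.anti fun x hx => h3.subset hx

/-! ### The treatment of an edge -/

/-- Empty both queues, and reset the conflict flags. -/
def reset : Program :=
  .seq (.write 8 (.lit 0) (.lit 0)) <| .seq (.write 9 (.lit 0) (.lit 0)) <|
  .seq (.write 10 (.lit 0) (.lit 0)) <| .seq (.write 8 (.lit 1) (.lit 0)) <|
  .seq (.write 9 (.lit 1) (.lit 0)) <| .write 10 (.lit 1) (.lit 0)

/-- The test that propagation `σ` either has arcs left to expand or met a conflict. -/
def unfinished (σ : ℕ) : Expr :=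
  .add (.lt (.read 8 (.lit σ)) (.read 9 (.lit σ))) (.read 10 (.lit σ))

/-- The test that neither propagation has finished without conflict, and not both met one. -/
def running : Expr :=
  .mul (.mul (unfinished 0) (unfinished 1))
    (.sub (.lit 1) (.mul (.read 10 (.lit 0)) (.read 10 (.lit 1))))

/-- Expand one arc in the propagation `σ`, unless it met a conflict. -/
def turn (σ : ℕ) : Program :=
  .seq (.assign 4 (.lit σ)) (.cond (.read 10 (.lit σ)) .skip expand)

/-- Commit the arcs of the propagation `σ`. -/
def commit (σ : ℕ) : Program :=
  .seq (.assign 4 (.lit σ)) <| .seq (.assign 10 (.lit 0)) <|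
  .loop (.lt (.reg 10) (.read 9 (.reg 4))) <|
  .seq (.write 4 (pair (.read 6 (sided (.reg 10))) (.read 7 (sided (.reg 10)))) (.lit 1)) <|
  .assign 10 (.add (.reg 10) (.lit 1))

/-- Start the propagation `σ` with the arc whose ends are in the input arrays `x` and `y`. -/
def start (σ x y : ℕ) : Program :=
  .seq (.assign 4 (.lit σ)) <| .seq (.assign 8 (.read x (.reg 2))) <|
  .seq (.assign 9 (.read y (.reg 2))) append

/-- Propagate both orientations of an undecided edge `uv` alternately, one arc at a time. Commit the
arcs of the first propagation that finishes without conflict; if both meet a conflict, set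
register `3` to record that there is no TTO. -/
def decideEdge : Program :=
  .seq reset <| .seq (start 0 0 1) <| .seq (start 1 1 0) <|
  .seq (.loop running (.seq (turn 0) (turn 1))) <|
  .cond (unfinished 0) (.cond (unfinished 1) (.assign 3 (.lit 1)) (commit 1)) (commit 0)

/-- The input and the control registers, and the matrices, are unchanged. -/
structure Keep (s s' : State) : Prop where
  reg : ∀ x < 4, s'.reg x = s.reg x
  arr : ∀ a < 5, s'.arr a = s.arr a

theorem Frame.keep (hf : Frame n i σ s s') : Keep s s' :=
  ⟨fun x hx => hf.reg x (by omega), hf.arr⟩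

theorem Keep.trans {s₁ s₂ s₃ : State} (h : Keep s₁ s₂) (h' : Keep s₂ s₃) : Keep s₁ s₃ :=
  ⟨fun x hx => (h'.reg x hx).trans (h.reg x hx), fun a ha => (h'.arr a ha).trans (h.arr a ha)⟩

theorem Keep.setReg (s : State) {x v : ℕ} (hx : 4 ≤ x) : Keep s (s.setReg x v) :=
  ⟨fun y hy => by rw [State.setReg_reg, if_neg (by omega)], fun _ _ => rfl⟩

theorem Env.setReg (he : Env ℓ S i s) {x v : ℕ} (hx : 4 ≤ x) : Env ℓ S i (s.setReg x v) :=
  ⟨((Keep.setReg s hx).reg 0 (by omega)).trans he.size,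
    ((Keep.setReg s hx).reg 2 (by omega)).trans he.index, he.weight, he.committed, he.stamp_le⟩

/-- The propagation `σ` of the arc `x₀` after `J` turns. -/
def Thread (ℓ : Fin n → Fin n → ℕ) (S : List (Fin n × Fin n)) (i σ : ℕ) (x₀ : Fin n × Fin n)
    (J : ℕ) (Q : List (Fin n × Fin n)) (h c : ℕ) (s : State) : Prop :=
  Side i σ Q h c s ∧ Propagation ℓ S x₀ Q c ∧ h ≤ Q.length ∧ (c = 0 → h = J) ∧
    ∀ x ∈ Q.take h, ∀ w, Expanded ℓ S (Q.take h) Q x w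

theorem turn_spec (hℓ : ∀ a b, ℓ a b = ℓ b a) (hloop : ∀ a, ℓ a a = 0)
    (hB : Fit B ℓ i) (he : Env ℓ S i s) (hσ : σ < 2) (ht : Thread ℓ S i σ x₀ J Q h c s)
    (hh : c = 0 → h < Q.length) :
    Runs B (turn σ) s fun t s' => t ≤ 460 * n + 70 ∧ Keep s s' ∧ Env ℓ S i s' ∧
      (∀ τ < 2, τ ≠ σ → ∀ (Q : List (Fin n × Fin n)) (h c : ℕ), Side i τ Q h c s →
        Side i τ Q h c s') ∧
      ∃ Q' h' c', Thread ℓ S i σ x₀ (J + 1) Q' h' c' s' := by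
  obtain ⟨hs, hP, hle, hJ, hex⟩ := ht
  have h7 := hB.size
  have hc := hP.flag_le
  have hk : Keep s (s.setReg 4 σ) := .setReg s le_rfl
  have he₁ : Env ℓ S i (s.setReg 4 σ) := he.setReg le_rfl
  have hflag : (Expr.read 10 (.lit σ)).eval (s.setReg 4 σ) = c := hs.flag
  refine .seq (.assign (show σ ≤ B by omega) (.cond ⟨show σ ≤ B by omega, ?_⟩ (fun hm => .skip ?_)
    fun hm => ?_))
  · rw [← Expr.eval, Expr.eval, hflag]
    omega
  · change Expr.eval (s.setReg 4 σ) _ ≠ 0 at hm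
    rw [hflag] at hm
    refine ⟨?_, hk, he₁, fun τ _ _ Q h c hs => hs.setReg _ _, Q, h, c, hs.setReg _ _, hP, hle,
      fun h0 => absurd h0 hm, hex⟩
    simp only [Expr.cost]
    omega
  · change Expr.eval (s.setReg 4 σ) _ = 0 at hm
    rw [hflag] at hm
    refine (expand_spec hℓ hloop hB he₁ (by simp [State.setReg_reg]) hσ (hs.setReg _ _) hP
      (hh hm)).mono ?_
    rintro t s' ⟨h1, h2, Q', c', h3, h4, h5, h6⟩
    have hlen := h5.length_le
    have hlt := hh hm
    refine ⟨?_, hk.trans h2.keep, he₁.frame h2, fun τ hτ hne Q h c hs =>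
      h2.other τ hτ hne Q h c (hs.setReg _ _), Q', h + 1, c', h3, h4, by omega,
      fun _ => by rw [hJ hm], ?_⟩
    · simp only [Expr.cost]
      omega
    · have htake : Q'.take (h + 1) = Q.take h ++ [Q[h]] := by
        obtain ⟨r, rfl⟩ := h5
        rw [List.take_append_of_le_length (by omega), List.take_succ_eq_append_getElem]
      rw [htake]
      exact Expanded.snoc hℓ hex (fun x hx => List.mem_of_mem_take hx) (List.getElem_mem _)
        (fun x hx => h5.subset hx) h6

theorem commit_spec (hB : Fit B ℓ i) (he : Env ℓ S i s) (hσ : σ < 2) (hs : Side i σ Q h c s)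
    (hQ : Q.length ≤ n * n) :
    Runs B (commit σ) s fun t s' => t ≤ 30 * Q.length + 20 ∧ (∀ x < 4, s'.reg x = s.reg x) ∧
      (∀ a < 4, s'.arr a = s.arr a) ∧ Env ℓ (S ++ Q) i s' := by
  have h7 := hB.size
  refine .seq (.assign (show σ ≤ B by omega) (.seq (.assign (Nat.zero_le B) ?_)))
  refine Runs.loop (fun k t s' => ∃ w : ℕ, w ≤ Q.length ∧ k = Q.length - w ∧ t ≤ 30 * w ∧
    s'.reg 10 = w ∧ s'.reg 4 = σ ∧ (∀ x < 4, s'.reg x = s.reg x) ∧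
    (∀ a < 4, s'.arr a = s.arr a) ∧ Env ℓ (S ++ Q.take w) i s' ∧ Side i σ Q h c s')
    ?_ ?_ ?_ (k := Q.length) ⟨0, by omega, by omega, by omega, ?_, ?_, ?_, fun _ _ => rfl, ?_, ?_⟩
  · rintro k t s' ⟨w, hw, rfl, -, hw10, hr, -, -, -, hs'⟩
    simp only [Expr.Fits, Expr.eval, hw10, hr, hs'.tail]
    omega
  · rintro k t s' ⟨w, hw, rfl, ht, hw10, hr, hreg, harr, he', hs'⟩ hexit
    have hwn : w = Q.length := by
      simp only [Expr.eval, hw10, hr, hs'.tail] at hexit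
      split_ifs at hexit
      omega
    subst hwn
    rw [List.take_length] at he'
    refine ⟨?_, hreg, harr, he'⟩
    simp only [Expr.cost]
    omega
  · rintro k t s' ⟨w, hw, rfl, ht, hw10, hr, hreg, harr, he', hs'⟩ hexit
    have hwn : w < Q.length := by
      simp only [Expr.eval, hw10, hr, hs'.tail] at hexit
      split_ifs at hexit
      · assumption
      · omega
    have hn := Nat.le_mul_self n
    have hx1 := Q[w].1.2
    have hx2 := Q[w].2.2
    have hp1 : IsVertex B s' (.read 6 (sided (.reg 10))) Q[w].1 := by
      have : (sided (.reg 10)).eval s' = 2 * w + σ := by simp [sided, Expr.eval, hw10, hr]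
      refine ⟨⟨?_, ?_⟩, ?_⟩
      · simp only [sided, Expr.Fits, Expr.eval, hw10, hr]
        omega
      · rw [this, hs'.fst w hwn]
        omega
      · rw [Expr.eval, this, hs'.fst w hwn]
    have hp2 : IsVertex B s' (.read 7 (sided (.reg 10))) Q[w].2 := by
      have : (sided (.reg 10)).eval s' = 2 * w + σ := by simp [sided, Expr.eval, hw10, hr]
      refine ⟨⟨?_, ?_⟩, ?_⟩
      · simp only [sided, Expr.Fits, Expr.eval, hw10, hr]
        omega
      · rw [this, hs'.snd w hwn]
        omega
      · rw [Expr.eval, this, hs'.snd w hwn]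
    obtain ⟨f1, v1⟩ := pair_spec hB.size he'.size hp1 hp2
    refine .seq (.write f1 (show 1 ≤ B by omega) (.assign ?_ ⟨Q.length - (w + 1), by omega, w + 1,
      hwn, rfl, ?_, ?_, ?_, ?_, ?_, ?_, ?_⟩))
    · simp only [Expr.Fits, Expr.eval, State.setArr_reg, hw10]
      omega
    · simp only [Expr.cost, pair, sided]
      omega
    · simp [State.setReg_reg, Expr.eval, State.setArr_reg, hw10]
    · simpa [State.setReg_reg, State.setArr_reg] using hr
    · intro x hx
      rw [State.setReg_reg, if_neg (by omega), State.setArr_reg]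
      exact hreg x hx
    · intro a ha
      ext x
      rw [State.setReg_arr, State.setArr_arr, if_neg (by omega), harr a ha]
    · refine Env.setReg ?_ (by omega)
      refine ⟨he'.size, he'.index, fun a b => ?_, fun a b => ?_, fun x => ?_⟩
      · rw [State.setArr_arr, if_neg (by omega)]
        exact he'.weight a b
      · rw [State.setArr_arr, v1, he'.committed, List.take_succ_eq_append_getElem hwn]
        simp only [true_and, Expr.eval, ← List.append_assoc]
        by_cases hab : (a, b) = Q[w]
        · rw [if_pos (by rw [← hab]), if_pos (by
            rw [hab]
            exact List.mem_append_right _ (List.mem_singleton_self _))]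
        · rw [if_neg fun heq => hab (Prod.ext (pair_inj heq).1 (pair_inj heq).2)]
          refine if_congr ?_ rfl rfl
          rw [List.mem_append (t := [Q[w]]), List.mem_singleton, or_iff_left hab]
      · rw [State.setArr_arr, if_neg (by omega)]
        exact he'.stamp_le x
    · refine Side.setReg ?_ _ _
      constructor <;> simp only [State.setArr_arr, Nat.reduceEqDiff, false_and, if_false]
      · exact hs'.head
      · exact hs'.tail
      · exact hs'.flag
      · exact hs'.fst
      · exact hs'.snd
      · exact hs'.mark
  · simp [State.setReg_reg, Expr.eval]
  · simp [State.setReg_reg, Expr.eval]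
  · intro x hx
    simp only [State.setReg_reg]
    rw [if_neg (by omega), if_neg (by omega)]
  · rw [List.take_zero, List.append_nil]
    exact (he.setReg (by omega)).setReg (by omega)
  · exact (hs.setReg _ _).setReg _ _

theorem reset_spec (hB : 1 ≤ B) (hfresh : ∀ x, s.arr 5 x ≤ i) :
    Runs B reset s fun t s' => t ≤ 30 ∧ s'.reg = s.reg ∧ (∀ a < 6, s'.arr a = s.arr a) ∧
      Side (n := n) i 0 [] 0 0 s' ∧ Side (n := n) i 1 [] 0 0 s' := by
  refine .seq (.write (Nat.zero_le B) (Nat.zero_le B) <| .seq <| .write (Nat.zero_le B)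
    (Nat.zero_le B) <| .seq <| .write (Nat.zero_le B) (Nat.zero_le B) <| .seq <| .write hB
    (Nat.zero_le B) <| .seq <| .write hB (Nat.zero_le B) <| .write hB (Nat.zero_le B) ?_)
  refine ⟨by simp only [Expr.cost]; omega, rfl, fun a ha => ?_, ?_, ?_⟩
  · ext x
    simp only [State.setArr_arr]
    iterate 6 rw [if_neg (by omega)]
  all_goals
    refine ⟨by simp [State.setArr_arr, Expr.eval], by simp [State.setArr_arr, Expr.eval],
      by simp [State.setArr_arr, Expr.eval], fun j hj => absurd hj (Nat.not_lt_zero j),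
      fun j hj => absurd hj (Nat.not_lt_zero j), fun a b => ?_⟩
    simp only [State.setArr_arr, Nat.reduceEqDiff, false_and, if_false, List.not_mem_nil, iff_false]
    intro h
    have := h ▸ hfresh _
    omega

theorem start_spec (hloop : ∀ a, ℓ a a = 0) (hB : Fit B ℓ i) (he : Env ℓ S i s)
    (hσ : σ < 2) (hS : IsPartialTTO ℓ fun a b => (a, b) ∈ S) {x y : ℕ}
    {u v : Fin n} (hu : s.arr x i = u) (hv : s.arr y i = v)
    (huv : Undecided ℓ (fun a b => (a, b) ∈ S) u v) (hs : Side (n := n) i σ [] 0 0 s) :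
    Runs B (start σ x y) s fun t s' => t ≤ 110 ∧ Keep s s' ∧ Env ℓ S i s' ∧
      (∀ τ < 2, τ ≠ σ → ∀ (Q : List (Fin n × Fin n)) (h c : ℕ), Side i τ Q h c s →
        Side i τ Q h c s') ∧
      Thread ℓ S i σ (u, v) 0 [(u, v)] 0 0 s' := by
  have h7 := hB.size
  have h8 := hB.index
  have hn := Nat.le_mul_self n
  have hu2 := u.2
  have hv2 := v.2
  have hi := he.index
  refine .seq (.assign (show σ ≤ B by omega) <| .seq <| .assign ?_ <| .seq <| .assign ?_ ?_)
  iterate 2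
    simp only [Expr.Fits, Expr.eval, State.setReg_reg, State.setReg_arr, Nat.reduceEqDiff, if_false,
      hi, hu, hv]
    omega
  refine (append_spec (s := ((s.setReg 4 _).setReg 8 _).setReg 9 _) (p := u) (q := v) hB
    (((he.setReg (by omega)).setReg (by omega)).setReg (by omega)) ?_ hσ
    (((hs.setReg _ _).setReg _ _).setReg _ _) (Nat.zero_le _) ?_ ?_).mono ?_
  · simp [State.setReg_reg, Expr.eval]
  · simp [State.setReg_reg, State.setReg_arr, Expr.eval, hi, hu]
  · simp [State.setReg_reg, State.setReg_arr, Expr.eval, hi, hv]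
  · rintro t s' ⟨h1, h2, h3, c', h4, h5, h6⟩
    have hc : c' = 0 := h5 fun hm => hm.elim huv.2.2 (List.not_mem_nil)
    subst hc
    refine ⟨?_, ?_, ?_, ?_, h6, Propagation.singleton hS hloop huv, Nat.zero_le _, fun _ => rfl,
      fun x hx => ?_⟩
    · simp only [Expr.cost]
      omega
    · exact (((Keep.setReg s (by omega)).trans (.setReg _ (by omega))).trans
        (.setReg _ (by omega))).trans h3.keep
    · exact Env.frame (((he.setReg (by omega)).setReg (by omega)).setReg (by omega)) h3
    · intro τ hτ hne Q h c hs
      exact h3.other τ hτ hne Q h c (((hs.setReg _ _).setReg _ _).setReg _ _)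
    · simp at hx

theorem unfinished_spec (hB : Fit B ℓ i) (hσ : σ < 2) (ht : Thread ℓ S i σ x₀ J Q h c s) :
    (unfinished σ).Bdd B s 2 ∧ ((unfinished σ).eval s ≠ 0 ↔ h < Q.length ∨ c ≠ 0) := by
  obtain ⟨hs, hP, hle, -, -⟩ := ht
  have h7 := hB.size
  have hlen := hP.nodup.length_le_mul_self
  have hc := hP.flag_le
  have hf : (Expr.lit σ).Fits B s := show σ ≤ B by omega
  have h8 : s.arr 8 ((Expr.lit σ).eval s) = h := hs.head
  have h9 : s.arr 9 ((Expr.lit σ).eval s) = Q.length := hs.tail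
  have h10 : s.arr 10 ((Expr.lit σ).eval s) = c := hs.flag
  constructor
  · exact .add (k := 1) (l := 1) (.lt ⟨hf, by omega⟩ ⟨hf, by omega⟩ (by omega))
      (.read hf (by omega) (by omega)) (by omega)
  · simp only [unfinished, Expr.eval, hs.head, hs.tail, hs.flag]
    split_ifs with hlt <;> simp [hlt]

/-- If both orientations of an edge lead to a conflict, then there is no TTO: it could be assumed
to extend the committed arcs. -/
theorem not_exists_isWeightTTO (hℓ : ∀ a b, ℓ a b = ℓ b a)
    (hS : IsPartialTTO ℓ fun a b => (a, b) ∈ S) {u v : Fin n} (huv : 0 < ℓ u v)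
    {Q₀ Q₁ : List (Fin n × Fin n)} {c₀ c₁ : ℕ} (h₀ : Propagation ℓ S (u, v) Q₀ c₀)
    (h₁ : Propagation ℓ S (v, u) Q₁ c₁) (hc₀ : c₀ ≠ 0) (hc₁ : c₁ ≠ 0) :
    ¬ ∃ O, IsWeightTTO ℓ O := by
  rintro ⟨O, hO⟩
  obtain ⟨O', hO', hSO⟩ := hS.exists_extension hℓ hO
  have hcl := hO'.forcingClosed hℓ
  rcases hO'.total huv with h | h
  · obtain ⟨p, q, hpq, hqp⟩ := h₀.conflict hc₀ O' hcl (fun x hx => hSO _ _ hx) h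
    exact hO'.asymm hpq hqp
  · obtain ⟨p, q, hpq, hqp⟩ := h₁.conflict hc₁ O' hcl (fun x hx => hSO _ _ hx) h
    exact hO'.asymm hpq hqp

/-- The treatment of an undecided edge `uv`. After `J` turns, which take `O(n)` steps each, a
propagation without conflict has expanded exactly `J` arcs. When one has finished, these are the
arcs that are committed, which pays for the turns of both propagations; if both meet a conflict,
the number of turns is at most the number `M` of all arcs. -/
theorem decideEdge_spec (hℓ : ∀ a b, ℓ a b = ℓ b a) (hloop : ∀ a, ℓ a a = 0)
    (hB : Fit B ℓ i) (he : Env ℓ S i s) (hfresh : ∀ x, s.arr 5 x ≤ i)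
    (hS : IsPartialTTO ℓ fun a b => (a, b) ∈ S) (hnodup : S.Nodup)
    (hM : ∀ Q : List (Fin n × Fin n), Q.Nodup → (∀ x ∈ Q, 0 < ℓ x.1 x.2) → Q.length ≤ M)
    {u v : Fin n} (hu : s.arr 0 i = u) (hv : s.arr 1 i = v)
    (huv : Undecided ℓ (fun a b => (a, b) ∈ S) u v) (h3 : s.reg 3 = 0) :
    Runs B decideEdge s fun t s' => (∀ x < 3, s'.reg x = s.reg x) ∧
      (∀ a < 4, s'.arr a = s.arr a) ∧
      ((s'.reg 3 = 0 ∧ ∃ S', Env ℓ S' i s' ∧ IsPartialTTO ℓ (fun a b => (a, b) ∈ S') ∧ S'.Nodup ∧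
          (∀ x ∈ S, x ∈ S') ∧ ((u, v) ∈ S' ∨ (v, u) ∈ S') ∧
          t + (1000 * n + 1000) * S.length ≤ (1000 * n + 1000) * S'.length + 400) ∨
        (s'.reg 3 = 1 ∧ (¬ ∃ O, IsWeightTTO ℓ O) ∧ t ≤ (1000 * n + 1000) * M + 400)) := by
  have h7 := hB.size
  have hrc : running.cost = 25 := rfl
  have huc : ∀ τ, (unfinished τ).cost = 8 := fun _ => rfl
  refine .seq ((reset_spec (n := n) (by omega) hfresh).mono ?_)
  rintro t1 s1 ⟨ht1, hreg1, harr1, hs0, hs1⟩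
  have hk1 : Keep s s1 := ⟨fun x _ => by rw [hreg1], fun a ha => harr1 a (by omega)⟩
  have he1 : Env ℓ S i s1 := ⟨hreg1 ▸ he.size, hreg1 ▸ he.index,
    by rw [harr1 3 (by omega)]; exact he.weight, by rw [harr1 4 (by omega)]; exact he.committed,
    by rw [harr1 5 (by omega)]; exact he.stamp_le⟩
  refine .seq ((start_spec hloop hB he1 (σ := 0) (by omega) hS (x := 0) (y := 1)
    (by rw [harr1 0 (by omega)]; exact hu) (by rw [harr1 1 (by omega)]; exact hv) huv hs0).mono ?_)
  rintro t2 s2 ⟨ht2, hk2, he2, ho2, hT0⟩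
  have hk2 := hk1.trans hk2
  refine .seq ((start_spec hloop hB he2 (σ := 1) (by omega) hS (x := 1) (y := 0)
    (by rw [hk2.arr 1 (by omega)]; exact hv) (by rw [hk2.arr 0 (by omega)]; exact hu)
    (huv.symm hℓ) (ho2 1 (by omega) (by omega) _ _ _ hs1)).mono ?_)
  rintro t3 s3 ⟨ht3, hk3, he3, ho3, hT1⟩
  have hk3 := hk2.trans hk3
  have hT0 : Thread ℓ S i 0 (u, v) 0 [(u, v)] 0 0 s3 :=
    ⟨ho3 0 (by omega) (by omega) _ _ _ hT0.1, hT0.2⟩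
  -- `J` turns have been taken
  refine .seq (Runs.loop (fun k t s' => ∃ J Q₀ h₀ c₀ Q₁ h₁ c₁, k = M - J ∧ J ≤ M ∧
    t ≤ (920 * n + 170) * J ∧ Keep s s' ∧ Env ℓ S i s' ∧ Thread ℓ S i 0 (u, v) J Q₀ h₀ c₀ s' ∧
    Thread ℓ S i 1 (v, u) J Q₁ h₁ c₁ s') ?_ ?_ ?_ (k := M)
    ⟨0, _, _, _, _, _, _, by omega, by omega, by omega, hk3, he3, hT0, hT1⟩)
  · rintro k t s' ⟨J, Q₀, h₀, c₀, Q₁, h₁, c₁, -, -, -, -, -, hT0, hT1⟩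
    have hf0 := (unfinished_spec hB (by omega) hT0).1
    have hf1 := (unfinished_spec hB (by omega) hT1).1
    have hc0 := hT0.2.1.flag_le
    have hc1 := hT1.2.1.flag_le
    have h10 : s'.arr 10 ((Expr.lit 0).eval s') = c₀ := hT0.1.flag
    have h11 : s'.arr 10 ((Expr.lit 1).eval s') = c₁ := hT1.1.flag
    exact (Expr.Bdd.mul (k := 2 * 2) (l := 1) (.mul hf0 hf1 (by omega)) (.sub (.lit (by omega))
      (Expr.Bdd.mul (k := 1) (l := 1)
        (.read (Expr.Bdd.lit (Nat.zero_le B)).1 (by omega) (by omega))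
        (.read (Expr.Bdd.lit (by omega)).1 (by omega) (by omega)) (by omega)).1) (by omega)).1
  · rintro k t s' ⟨J, Q₀, h₀, c₀, Q₁, h₁, c₁, rfl, hJ, ht, hk, he', hT0, hT1⟩ hexit
    obtain ⟨hf0, hv0⟩ := unfinished_spec hB (by omega) hT0
    obtain ⟨hf1, hv1⟩ := unfinished_spec hB (by omega) hT1
    have hc0 := hT0.2.1.flag_le
    have hc1 := hT1.2.1.flag_le
    have hrun : running.eval s' = (unfinished 0).eval s' * (unfinished 1).eval s' *
        (1 - c₀ * c₁) := by
      rw [← hT0.1.flag, ← hT1.1.flag]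
      rfl
    -- the outcome if one of the propagations has finished without conflict
    have hfinish : ∀ {σ x₀ Q h c}, σ < 2 → Thread ℓ S i σ x₀ J Q h c s' →
        (unfinished σ).eval s' = 0 → (x₀ = (u, v) ∨ x₀ = (v, u)) →
        Runs B (commit σ) s' fun t' s'' => (∀ x < 3, s''.reg x = s.reg x) ∧
          (∀ a < 4, s''.arr a = s.arr a) ∧ s''.reg 3 = 0 ∧ ∃ S', Env ℓ S' i s'' ∧
          IsPartialTTO ℓ (fun a b => (a, b) ∈ S') ∧ S'.Nodup ∧
          (∀ x ∈ S, x ∈ S') ∧ ((u, v) ∈ S' ∨ (v, u) ∈ S') ∧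
          t + t' + (1000 * n + 1000) * S.length ≤ (1000 * n + 1000) * S'.length + 20 := by
      intro σ x₀ Q h c hσ hT hzero hx
      have hun := (unfinished_spec hB hσ hT).2
      obtain ⟨hs, hP, hle, hhJ, hex⟩ := hT
      have hlen := hP.nodup.length_le_mul_self
      have hnot : ¬ (h < Q.length ∨ c ≠ 0) := fun hcon => hun.2 hcon hzero
      rw [not_or, not_not] at hnot
      obtain ⟨hnot, rfl⟩ := hnot
      have hQJ : Q.length = J := by
        have := hhJ rfl
        omega
      rw [List.take_of_length_le (by omega)] at hex
      refine (commit_spec hB he' hσ hs hlen).mono ?_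
      rintro t' s'' ⟨g1, g2, g3, g4⟩
      refine ⟨fun x hx => (g2 x (by omega)).trans (hk.reg x (by omega)),
        fun a ha => (g3 a ha).trans (hk.arr a (by omega)), ?_, S ++ Q, g4,
        hP.isPartialTTO hℓ hS hex, ?_, fun x hx => List.mem_append_left _ hx, ?_, ?_⟩
      · rw [g2 3 (by omega), hk.reg 3 (by omega), h3]
      · rw [List.nodup_append]
        exact ⟨hnodup, hP.nodup, fun a ha b hb hab => hP.disjoint b hb (hab ▸ ha)⟩
      · have := hP.start
        rcases hx with rfl | rfl
        · exact Or.inl (List.mem_append_right _ this)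
        · exact Or.inr (List.mem_append_right _ this)
      · rw [List.length_append, mul_add, hQJ]
        have : (920 * n + 170) * J + 30 * J ≤ (1000 * n + 1000) * J := by
          rw [← add_mul]
          exact Nat.mul_le_mul_right J (by omega)
        omega
    refine .cond hf0.1 (fun hm0 => .cond hf1.1 (fun hm1 => ?_) fun hm1 => ?_) fun hm0 => ?_
    · have hc : c₀ = 1 ∧ c₁ = 1 := by
        rw [hrun, mul_eq_zero, mul_eq_zero, or_iff_right hm0, or_iff_right hm1] at hexit
        interval_cases c₀ <;> interval_cases c₁ <;> simp_all
      refine .assign (show 1 ≤ B by omega) ⟨fun x hx => ?_, fun a ha => ?_, Or.inr ⟨?_, ?_, ?_⟩⟩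
      · rw [State.setReg_reg, if_neg (by omega)]
        exact hk.reg x (by omega)
      · exact hk.arr a (by omega)
      · simp [State.setReg_reg, Expr.eval]
      · exact not_exists_isWeightTTO hℓ hS huv.1 hT0.2.1 hT1.2.1 (by omega) (by omega)
      · have h1 : (920 * n + 170) * J ≤ (1000 * n + 1000) * M :=
          Nat.mul_le_mul (by omega) hJ
        simp only [hrc, huc, Expr.cost]
        omega
    · refine (hfinish (by omega) hT1 hm1 (Or.inr rfl)).mono ?_
      rintro t' s'' ⟨g1, g2, g3, S', g4, g5, g6, g7, g8, g9⟩
      refine ⟨g1, g2, Or.inl ⟨g3, S', g4, g5, g6, g7, g8, ?_⟩⟩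
      rw [hrc, huc, huc]
      omega
    · refine (hfinish (by omega) hT0 hm0 (Or.inl rfl)).mono ?_
      rintro t' s'' ⟨g1, g2, g3, S', g4, g5, g6, g7, g8, g9⟩
      refine ⟨g1, g2, Or.inl ⟨g3, S', g4, g5, g6, g7, g8, ?_⟩⟩
      rw [hrc, huc]
      omega
  · rintro k t s' ⟨J, Q₀, h₀, c₀, Q₁, h₁, c₁, rfl, hJ, ht, hk, he', hT0, hT1⟩ hexit
    have hv0 := (unfinished_spec hB (by omega) hT0).2
    have hv1 := (unfinished_spec hB (by omega) hT1).2
    have hrun : running.eval s' = (unfinished 0).eval s' * (unfinished 1).eval s' *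
        (1 - c₀ * c₁) := by
      rw [← hT0.1.flag, ← hT1.1.flag]
      rfl
    rw [hrun, mul_ne_zero_iff, mul_ne_zero_iff, hv0, hv1] at hexit
    obtain ⟨⟨hx0, hx1⟩, hx2⟩ := hexit
    have hJM : J < M := by
      have hm0 := hM Q₀ hT0.2.1.nodup hT0.2.1.pos
      have hm1 := hM Q₁ hT1.2.1.nodup hT1.2.1.pos
      have hj0 := hT0.2.2.2.1
      have hj1 := hT1.2.2.2.1
      by_cases hc0 : c₀ = 0
      · have := hj0 hc0
        have := hx0.resolve_right (not_not.2 hc0)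
        omega
      · have hc1 : c₁ = 0 := by
          have hl0 := hT0.2.1.flag_le
          have hl1 := hT1.2.1.flag_le
          interval_cases c₀ <;> interval_cases c₁ <;> simp_all
        have := hj1 hc1
        have := hx1.resolve_right (not_not.2 hc1)
        omega
    refine .seq ((turn_spec hℓ hloop hB he' (by omega) hT0
      fun h0 => hx0.resolve_right (not_not.2 h0)).mono ?_)
    rintro t1' s1' ⟨k1, k2, k3, k4, Q₀', h₀', c₀', k5⟩
    refine (turn_spec hℓ hloop hB k3 (by omega) (J := J)
      ⟨k4 1 (by omega) (by omega) _ _ _ hT1.1, hT1.2⟩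
      fun h0 => hx1.resolve_right (not_not.2 h0)).mono ?_
    rintro t2' s2' ⟨l1, l2, l3, l4, Q₁', h₁', c₁', l5⟩
    refine ⟨M - (J + 1), by omega, J + 1, Q₀', h₀', c₀', Q₁', h₁', c₁', rfl, hJM, ?_,
      (hk.trans k2).trans l2, l3, ⟨l4 0 (by omega) (by omega) _ _ _ k5.1, k5.2⟩, l5⟩
    rw [hrc, mul_add]
    omega

end TTOProgram

/-! ### Edge lists -/

namespace TemporalGraph

variable {V : Type*} (𝒢 : TemporalGraph V)

open Classical in
/-- The label of `ab` plus one if `ab` is an edge, and `0` otherwise. -/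
noncomputable def weight (a b : V) : ℕ :=
  if h : 𝒢.graph.Adj a b then 𝒢.lab h + 1 else 0

variable {𝒢}

theorem weight_of_adj {a b : V} (h : 𝒢.graph.Adj a b) : 𝒢.weight a b = 𝒢.lab h + 1 :=
  dif_pos h

theorem weight_pos_iff {a b : V} : 0 < 𝒢.weight a b ↔ 𝒢.graph.Adj a b := by
  by_cases h : 𝒢.graph.Adj a b <;> simp [weight, h]

theorem weight_comm (a b : V) : 𝒢.weight a b = 𝒢.weight b a := by
  by_cases h : 𝒢.graph.Adj a b
  · have hs : s(a, b) = s(b, a) := Sym2.eq_swap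
    rw [weight_of_adj h, weight_of_adj h.symm]
    simp only [lab, hs]
  · rw [weight, weight, dif_neg h, dif_neg fun h' => h h'.symm]

theorem weight_self (a : V) : 𝒢.weight a a = 0 := by
  simp [weight]

theorem weight_le {W : ℕ} (hW : ∀ e, 𝒢.label e ≤ W) (a b : V) : 𝒢.weight a b ≤ W + 1 := by
  by_cases h : 𝒢.graph.Adj a b
  · rw [weight_of_adj h]
    exact Nat.succ_le_succ (hW _)
  · simp [weight, h]

theorem isTComparability_iff : 𝒢.IsTComparability ↔ ∃ O, IsWeightTTO 𝒢.weight O := by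
  constructor
  · rintro ⟨O, ⟨hadj, hxor⟩, ht⟩
    refine ⟨fun a b => (a, b) ∈ O, fun {a b} h => weight_pos_iff.2 (hadj a b h),
      fun {a b} h h' => ?_, fun {a b} h => ?_, fun {a b c} h h' hle => ?_⟩
    · exact (hxor a b (hadj a b h)).elim (fun hx => hx.2 h') fun hx => hx.2 h
    · exact (hxor a b (weight_pos_iff.1 h)).imp And.left And.left
    · have hab := hadj a b h
      have hbc := hadj b c h'
      rw [weight_of_adj hab, weight_of_adj hbc] at hle
      obtain ⟨h1, hac, h2⟩ := ht a b c hab hbc h h' (by omega)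
      rw [weight_of_adj hac, weight_of_adj hbc]
      exact ⟨h1, by omega⟩
  · rintro ⟨O, hO⟩
    refine ⟨{x | O x.1 x.2}, ⟨fun a b h => weight_pos_iff.1 (hO.pos h), fun a b h => ?_⟩,
      fun a b c hab hbc h h' hle => ?_⟩
    · rcases hO.total (weight_pos_iff.2 h) with h1 | h1
      · exact Or.inl ⟨h1, hO.asymm h1⟩
      · exact Or.inr ⟨h1, hO.asymm h1⟩
    · obtain ⟨h1, h2⟩ := hO.trans h h' (by rw [weight_of_adj hab, weight_of_adj hbc]; omega)
      have hac := weight_pos_iff.1 (hO.pos h1)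
      rw [weight_of_adj hac, weight_of_adj hbc] at h2
      exact ⟨h1, hac, by omega⟩

variable {L : List (V × V × ℕ)}

theorem IsEdgeList.weight_of_mem (hL : 𝒢.IsEdgeList L) {x : V × V × ℕ} (hx : x ∈ L) :
    𝒢.weight x.1 x.2.1 = x.2.2 + 1 := by
  obtain ⟨h, ht⟩ := (hL.2 _ _).1 ⟨x, hx, rfl, rfl⟩
  rw [weight_of_adj h, ← ht]
  rfl

theorem IsEdgeList.exists_mem (hL : 𝒢.IsEdgeList L) {a b : V} (h : 0 < 𝒢.weight a b) :
    ∃ x ∈ L, s(x.1, x.2.1) = s(a, b) := by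
  obtain ⟨x, hx, hs, -⟩ := (hL.2 s(a, b) _).2 ⟨weight_pos_iff.1 h, rfl⟩
  exact ⟨x, hx, hs⟩

theorem IsEdgeList.length_eq (hL : 𝒢.IsEdgeList L) : L.length = 𝒢.numEdges := by
  classical
  have h : 𝒢.graph.edgeSet = ((L.map fun x => s(x.1, x.2.1)).toFinset : Set (Sym2 V)) := by
    ext e
    simp only [List.coe_toFinset, Set.mem_ofPred_eq, List.mem_map]
    constructor
    · intro he
      obtain ⟨x, hx, hs, -⟩ := (hL.2 e _).2 ⟨he, rfl⟩
      exact ⟨x, hx, hs⟩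
    · rintro ⟨x, hx, hs⟩
      exact ((hL.2 e _).1 ⟨x, hx, hs, rfl⟩).1
  rw [numEdges, h, Set.ncard_coe_finset, List.toFinset_card_of_nodup hL.1, List.length_map]

/-- There are two arcs for each edge. -/
theorem IsEdgeList.length_arcs_le (hL : 𝒢.IsEdgeList L) {Q : List (V × V)} (hQ : Q.Nodup)
    (hpos : ∀ x ∈ Q, 0 < 𝒢.weight x.1 x.2) : Q.length ≤ 2 * L.length := by
  have hsub : Q ⊆ L.map (fun x => (x.1, x.2.1)) ++ L.map fun x => (x.2.1, x.1) := by
    rintro ⟨a, b⟩ hx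
    obtain ⟨⟨u, v, t⟩, hy, hs⟩ := hL.exists_mem (hpos _ hx)
    rw [Sym2.eq_iff] at hs
    rw [List.mem_append, List.mem_map, List.mem_map]
    rcases hs with ⟨rfl, rfl⟩ | ⟨rfl, rfl⟩
    · exact Or.inl ⟨_, hy, rfl⟩
    · exact Or.inr ⟨_, hy, rfl⟩
  have := (hQ.subperm hsub).length_le
  rw [List.length_append, List.length_map, List.length_map] at this
  omega

theorem IsEdgeList.length_le {n : ℕ} {𝒢 : TemporalGraph (Fin n)} {L : List (Fin n × Fin n × ℕ)}
    (hL : 𝒢.IsEdgeList L) : L.length ≤ n * n := by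
  have h : ((L.map fun x => (x.1, x.2.1)).map fun y => s(y.1, y.2)).Nodup := by
    rw [List.map_map]
    exact hL.1
  have h := h.of_map.length_le_mul_self
  rwa [List.length_map] at h

end TemporalGraph

/-! ### The recognition algorithm -/

namespace TTOProgram

open RAM

/-- Enter the weight of the next edge of the input into the matrix, at both of its cells. -/
def load : Program :=
  .seq (.assign 8 (.read 0 (.reg 2))) <| .seq (.assign 9 (.read 1 (.reg 2))) <|
  .seq (.write 3 (pair (.reg 8) (.reg 9)) (.add (.read 2 (.reg 2)) (.lit 1))) <|
  .seq (.write 3 (pair (.reg 9) (.reg 8)) (.add (.read 2 (.reg 2)) (.lit 1))) <|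
  .assign 2 (.add (.reg 2) (.lit 1))

/-- Compute the matrix of weights. -/
def setup : Program :=
  .seq (.loop (.lt (.reg 2) (.reg 1)) load) (.assign 2 (.lit 0))

/-- Decide the next edge of the input unless it has an orientation already. -/
def nextEdge : Program :=
  .seq (.assign 8 (.read 0 (.reg 2))) <| .seq (.assign 9 (.read 1 (.reg 2))) <|
  .seq (.cond (.add (.read 4 (pair (.reg 8) (.reg 9))) (.read 4 (pair (.reg 9) (.reg 8))))
    .skip decideEdge) <|
  .assign 2 (.add (.reg 2) (.lit 1))

/-- Decide the edges of the input in turn, until there is none left or one cannot be decided. -/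
def recognize : Program :=
  .seq setup <|
  .seq (.loop (.mul (.lt (.reg 2) (.reg 1)) (.sub (.lit 1) (.reg 3))) nextEdge) <|
  .assign 0 (.sub (.lit 1) (.reg 3))

variable {n B i j : ℕ} {𝒢 : TemporalGraph (Fin n)} {L : List (Fin n × Fin n × ℕ)}

theorem inputState_arr_of_three_le {a : ℕ} (ha : 3 ≤ a) (x : ℕ) :
    (inputState n L).arr a x = 0 := by
  simp only [inputState]
  split
  · rfl
  · rw [if_neg (by omega), if_neg (by omega), if_neg (by omega)]

theorem inputState_arr_zero (hi : i < L.length) : (inputState n L).arr 0 i = L[i].1 := by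
  simp [inputState, hi]

theorem inputState_arr_one (hi : i < L.length) : (inputState n L).arr 1 i = L[i].2.1 := by
  simp [inputState, hi]

theorem inputState_arr_two (hi : i < L.length) : (inputState n L).arr 2 i = L[i].2.2 := by
  simp [inputState, hi]

/-- What the configuration holds when `j` edges have been entered into the matrix. -/
structure Loaded (𝒢 : TemporalGraph (Fin n)) (L : List (Fin n × Fin n × ℕ)) (j : ℕ)
    (s : State) : Prop where
  reg : ∀ x < 4, x ≠ 2 → s.reg x = (inputState n L).reg x
  index : s.reg 2 = j
  arr : ∀ a ≠ 3, s.arr a = (inputState n L).arr a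
  weight : ∀ a b : Fin n, (∃ x ∈ L.take j, s(x.1, x.2.1) = s(a, b)) →
    s.arr 3 (a * n + b) = 𝒢.weight a b
  zero : ∀ a b : Fin n, (¬ ∃ x ∈ L.take j, s(x.1, x.2.1) = s(a, b)) → s.arr 3 (a * n + b) = 0

theorem load_spec (hL : 𝒢.IsEdgeList L) (hB : Fit B 𝒢.weight i) (hi : i < L.length) {s : State}
    (hs : Loaded 𝒢 L i s) : Runs B load s fun t s' => t ≤ 30 ∧ Loaded 𝒢 L (i + 1) s' := by
  have h7 := hB.size
  have h8 := hB.index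
  have hn : s.reg 0 = n := hs.reg 0 (by omega) (by omega)
  have hw := hL.weight_of_mem (List.getElem_mem hi)
  have hu : s.arr 0 i = L[i].1 := by rw [hs.arr 0 (by omega), inputState_arr_zero hi]
  have hv : s.arr 1 i = L[i].2.1 := by rw [hs.arr 1 (by omega), inputState_arr_one hi]
  have ht : s.arr 2 i = L[i].2.2 := by rw [hs.arr 2 (by omega), inputState_arr_two hi]
  have htake : ∀ a b, (∃ x ∈ L.take (i + 1), s(x.1, x.2.1) = s(a, b)) ↔
      (∃ x ∈ L.take i, s(x.1, x.2.1) = s(a, b)) ∨ s(L[i].1, L[i].2.1) = s(a, b) := by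
    intro a b
    rw [List.take_succ_eq_append_getElem hi]
    simp only [List.mem_append, List.mem_singleton, or_and_right, exists_or, exists_eq_left]
  generalize L[i] = x at hw hu hv ht htake
  obtain ⟨u, v, l⟩ := x
  dsimp only at hw hu hv ht htake
  have hwB := hB.weight u v
  have hu' : (u : ℕ) ≤ B := by
    have := Nat.le_mul_self n
    have := u.2
    omega
  have hv' : (v : ℕ) ≤ B := by
    have := Nat.le_mul_self n
    have := v.2
    omega
  refine .seq (.assign ?_ (.seq (.assign ?_ (.seq ?_))))
  · simp only [Expr.Fits, Expr.eval, hs.index, hu]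
    omega
  · simp only [Expr.Fits, Expr.eval, State.setReg_reg, State.setReg_arr, Nat.reduceEqDiff,
      if_false, hs.index, hv]
    omega
  set s2 := (s.setReg 8 (Expr.eval s (.read 0 (.reg 2)))).setReg 9
    (Expr.eval (s.setReg 8 (Expr.eval s (.read 0 (.reg 2)))) (.read 1 (.reg 2))) with hs2
  have r0 : s2.reg 0 = n := by simp [hs2, State.setReg_reg, hn]
  have r2 : s2.reg 2 = i := by simp [hs2, State.setReg_reg, hs.index]
  have r8 : s2.reg 8 = u := by simp [hs2, State.setReg_reg, Expr.eval, hs.index, hu]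
  have r9 : s2.reg 9 = v := by
    simp [hs2, State.setReg_reg, State.setReg_arr, Expr.eval, hs.index, hv]
  have hreg : ∀ x < 4, s2.reg x = s.reg x := fun x hx => by
    rw [hs2, State.setReg_reg, State.setReg_reg, if_neg (by omega), if_neg (by omega)]
  have harr : s2.arr = s.arr := rfl
  clear_value s2
  obtain ⟨f1, v1⟩ := pair_spec h7 r0 (isVertex_reg h7 r8) (isVertex_reg h7 r9)
  have fl : (Expr.add (.read 2 (.reg 2)) (.lit 1)).Fits B s2 := by
    simp only [Expr.Fits, Expr.eval, r2, harr, ht]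
    omega
  have vl : (Expr.add (.read 2 (.reg 2)) (.lit 1)).eval s2 = l + 1 := by
    simp only [Expr.eval, r2, harr, ht]
  refine .write f1 fl (.seq ?_)
  rw [v1, vl]
  set s3 := s2.setArr 3 (u * n + v) (l + 1) with hs3
  have hreg3 : s3.reg = s2.reg := rfl
  obtain ⟨f2, v2⟩ := pair_spec (s := s3) h7 r0 (isVertex_reg h7 r9) (isVertex_reg h7 r8)
  have fl : (Expr.add (.read 2 (.reg 2)) (.lit 1)).Fits B s3 := by
    simp only [Expr.Fits, Expr.eval, hs3, State.setArr_reg, r2, State.setArr_arr, Nat.reduceEqDiff,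
      false_and, if_false, harr, ht]
    omega
  have vl : (Expr.add (.read 2 (.reg 2)) (.lit 1)).eval s3 = l + 1 := by
    simp only [Expr.eval, hs3, State.setArr_reg, r2, State.setArr_arr, Nat.reduceEqDiff,
      false_and, if_false, harr, ht]
  refine .write f2 fl ?_
  rw [v2, vl]
  refine .assign ?_ ⟨?_, fun x hx hx2 => ?_, ?_, fun a ha => ?_, fun a b hab => ?_,
    fun a b hab => ?_⟩
  · simp only [Expr.Fits, Expr.eval, State.setArr_reg, hreg3, r2]
    omega
  · simp only [Expr.cost, pair]
    omega
  · rw [State.setReg_reg, if_neg hx2, State.setArr_reg, hreg3, hreg x hx]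
    exact hs.reg x hx hx2
  · simp [State.setReg_reg, Expr.eval, State.setArr_reg, hreg3, r2]
  · ext x
    rw [State.setReg_arr, State.setArr_arr, if_neg (by omega), hs3, State.setArr_arr,
      if_neg (by omega), harr, hs.arr a ha]
  · simp only [State.setReg_arr, State.setArr_arr, hs3, true_and, harr]
    split_ifs with h1 h2
    · obtain ⟨rfl, rfl⟩ := pair_inj h1
      rw [TemporalGraph.weight_comm, hw]
    · obtain ⟨rfl, rfl⟩ := pair_inj h2
      exact hw.symm
    · refine hs.weight a b (((htake a b).1 hab).resolve_right fun h => ?_)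
      rw [Sym2.eq_iff] at h
      rcases h with ⟨rfl, rfl⟩ | ⟨rfl, rfl⟩
      · exact h2 rfl
      · exact h1 rfl
  · simp only [State.setReg_arr, State.setArr_arr, hs3, true_and, harr]
    rw [htake, not_or] at hab
    rw [if_neg, if_neg]
    · exact hs.zero a b hab.1
    · intro h
      obtain ⟨rfl, rfl⟩ := pair_inj h
      exact hab.2 rfl
    · intro h
      obtain ⟨rfl, rfl⟩ := pair_inj h
      exact hab.2 Sym2.eq_swap

theorem setup_spec (hL : 𝒢.IsEdgeList L) (hB : ∀ i ≤ L.length, Fit B 𝒢.weight i) :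
    Runs B setup (inputState n L) fun t s => t ≤ 40 * L.length + 10 ∧
      (∀ x < 4, s.reg x = (inputState n L).reg x) ∧ (∀ a < 3, s.arr a = (inputState n L).arr a) ∧
      Env 𝒢.weight [] 0 s ∧ ∀ x, s.arr 5 x = 0 := by
  refine .seq (Runs.loop (fun k t s => ∃ j, k = L.length - j ∧ j ≤ L.length ∧ t ≤ 40 * j ∧
    Loaded 𝒢 L j s) ?_ ?_ ?_ (k := L.length) ⟨0, by omega, by omega, by omega, ?_⟩)
  · rintro k t s ⟨j, -, hj, -, hs⟩
    have h1 : s.reg 1 = L.length := hs.reg 1 (by omega) (by omega)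
    have := (hB L.length le_rfl).index
    simp only [Expr.Fits, hs.index, h1]
    omega
  · rintro k t s ⟨j, -, hj, ht, hs⟩ hexit
    have h1 : s.reg 1 = L.length := hs.reg 1 (by omega) (by omega)
    simp only [Expr.eval, hs.index, h1] at hexit
    obtain rfl : j = L.length := by
      by_contra hne
      rw [if_pos (by omega)] at hexit
      exact one_ne_zero hexit
    refine .assign (Nat.zero_le B) ⟨?_, fun x hx => ?_, fun a ha => hs.arr a (by omega),
      ⟨hs.reg 0 (by omega) (by omega), rfl, fun a b => ?_, fun a b => ?_, fun x => ?_⟩, fun x => ?_⟩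
    · simp only [Expr.cost]
      omega
    · rw [State.setReg_reg]
      split_ifs with h
      · rw [h]
        rfl
      · exact hs.reg x hx h
    · rw [State.setReg_arr]
      by_cases h : ∃ x ∈ L.take L.length, s(x.1, x.2.1) = s(a, b)
      · exact hs.weight a b h
      · rw [hs.zero a b h]
        refine (Nat.eq_zero_of_not_pos fun hpos => h ?_).symm
        rw [List.take_length]
        exact hL.exists_mem hpos
    · rw [State.setReg_arr, hs.arr 4 (by omega), inputState_arr_of_three_le (by omega)]
      simp
    · rw [State.setReg_arr, hs.arr 5 (by omega), inputState_arr_of_three_le (by omega)]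
      omega
    · rw [State.setReg_arr, hs.arr 5 (by omega), inputState_arr_of_three_le (by omega)]
  · rintro k t s ⟨j, rfl, hj, ht, hs⟩ hexit
    have h1 : s.reg 1 = L.length := hs.reg 1 (by omega) (by omega)
    simp only [Expr.eval, hs.index, h1] at hexit
    have hj' : j < L.length := by
      by_contra hne
      rw [if_neg (by omega)] at hexit
      exact hexit rfl
    refine (load_spec hL (hB j hj) hj' hs).mono ?_
    rintro t' s' ⟨ht', hs'⟩
    refine ⟨L.length - (j + 1), by omega, j + 1, rfl, hj', ?_, hs'⟩
    simp only [Expr.cost]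
    omega
  · exact ⟨fun _ _ _ => rfl, rfl, fun _ _ => rfl, fun a b h => by simp at h,
      fun a b _ => inputState_arr_of_three_le le_rfl _⟩

/-- What the configuration holds when `j` edges have been treated: either `S` orients all of them,
or register `3` records that there is no TTO. The time `t` is charged to the edges treated and to
the arcs committed. -/
structure Treated (𝒢 : TemporalGraph (Fin n)) (L : List (Fin n × Fin n × ℕ)) (j t : ℕ)
    (s : State) : Prop where
  length : s.reg 1 = L.length
  index : s.reg 2 = j
  arr : ∀ a < 3, s.arr a = (inputState n L).arr a
  outcome : (s.reg 3 = 0 ∧ ∃ S : List (Fin n × Fin n), Env 𝒢.weight S j s ∧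
      (∀ x, s.arr 5 x ≤ j) ∧ IsPartialTTO 𝒢.weight (fun a b => (a, b) ∈ S) ∧ S.Nodup ∧
      (∀ x ∈ L.take j, (x.1, x.2.1) ∈ S ∨ (x.2.1, x.1) ∈ S) ∧
      t ≤ (1000 * n + 1500) * j + (1000 * n + 1000) * S.length) ∨
    (s.reg 3 = 1 ∧ (¬ ∃ O, IsWeightTTO 𝒢.weight O) ∧
      t ≤ (1000 * n + 1500) * j + (1000 * n + 1000) * (4 * L.length))

theorem nextEdge_spec (hL : 𝒢.IsEdgeList L) (hB : Fit B 𝒢.weight j) (hj : j < L.length) {t : ℕ}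
    {s : State} (hs : Treated 𝒢 L j t s) (h3 : s.reg 3 = 0) :
    Runs B nextEdge s fun t' s' => Treated 𝒢 L (j + 1) (t + (8 + t')) s' := by
  have h7 := hB.size
  have h8 := hB.index
  obtain ⟨hlen, hidx, harr, ⟨-, S, he, hfresh, hS, hnodup, hdec, ht⟩ | ⟨h1, -⟩⟩ := hs
  swap
  · rw [h3] at h1
    exact absurd h1 zero_ne_one
  have hn := he.size
  have hw := hL.weight_of_mem (List.getElem_mem hj)
  have hu : s.arr 0 j = L[j].1 := by rw [harr 0 (by omega), inputState_arr_zero hj]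
  have hv : s.arr 1 j = L[j].2.1 := by rw [harr 1 (by omega), inputState_arr_one hj]
  have htake : ∀ x ∈ L.take (j + 1), x ∈ L.take j ∨ x = L[j] := by
    intro x hx
    rwa [List.take_succ_eq_append_getElem hj, List.mem_append, List.mem_singleton] at hx
  generalize L[j] = e at hw hu hv htake
  obtain ⟨u, v, l⟩ := e
  dsimp only at hw hu hv htake
  have hlt : ∀ w : Fin n, (w : ℕ) ≤ B := fun w => by
    have := Nat.le_mul_self n
    have := w.2
    omega
  have hu' := hlt u
  have hv' := hlt v
  refine .seq (.assign ?_ (.seq (.assign ?_ (.seq ?_))))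
  · simp only [Expr.Fits, Expr.eval, hidx, hu]
    omega
  · simp only [Expr.Fits, Expr.eval, State.setReg_reg, State.setReg_arr, Nat.reduceEqDiff,
      if_false, hidx, hv]
    omega
  set s2 := (s.setReg 8 (Expr.eval s (.read 0 (.reg 2)))).setReg 9
    (Expr.eval (s.setReg 8 (Expr.eval s (.read 0 (.reg 2)))) (.read 1 (.reg 2))) with hs2
  have r8 : s2.reg 8 = u := by simp [hs2, State.setReg_reg, Expr.eval, hidx, hu]
  have r9 : s2.reg 9 = v := by
    simp [hs2, State.setReg_reg, State.setReg_arr, Expr.eval, hidx, hv]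
  have hreg2 : ∀ x < 4, s2.reg x = s.reg x := fun x hx => by
    rw [hs2, State.setReg_reg, State.setReg_reg, if_neg (by omega), if_neg (by omega)]
  have harr2 : s2.arr = s.arr := rfl
  have he2 : Env 𝒢.weight S j s2 := (he.setReg (by omega)).setReg (by omega)
  clear_value s2
  obtain ⟨f1, v1⟩ := pair_spec h7 he2.size (isVertex_reg h7 r8) (isVertex_reg h7 r9)
  obtain ⟨f2, v2⟩ := pair_spec h7 he2.size (isVertex_reg h7 r9) (isVertex_reg h7 r8)
  have e1 := he2.committed u v
  have e2 := he2.committed v u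
  refine .cond (Expr.Bdd.add (k := 1) (l := 1) (.read f1 ?_ (by omega)) (.read f2 ?_ (by omega))
    (by omega)).1 (fun hm => .skip ?_) fun hm => ?_
  · rw [v1, e1]
    split_ifs <;> omega
  · rw [v2, e2]
    split_ifs <;> omega
  · have hor : (u, v) ∈ S ∨ (v, u) ∈ S := by
      by_contra hno
      rw [not_or] at hno
      rw [Expr.eval, Expr.eval, Expr.eval, v1, v2, e1, e2, if_neg hno.1, if_neg hno.2] at hm
      exact hm rfl
    have hr2 := he2.index
    refine .assign ?_ ⟨?_, ?_, fun a ha => ?_, Or.inl ⟨?_, S, ⟨?_, ?_, ?_, ?_, ?_⟩, ?_, hS, hnodup,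
      fun x hx => ?_, ?_⟩⟩
    · simp only [Expr.Fits, Expr.eval, hr2]
      omega
    · rw [State.setReg_reg, if_neg (by omega), hreg2 1 (by omega), hlen]
    · simp [State.setReg_reg, Expr.eval, hr2]
    · rw [State.setReg_arr, harr2, harr a ha]
    · rw [State.setReg_reg, if_neg (by omega), hreg2 3 (by omega), h3]
    · rw [State.setReg_reg, if_neg (by omega), he2.size]
    · simp [State.setReg_reg, Expr.eval, hr2]
    · exact he2.weight
    · exact he2.committed
    · exact fun x => (he2.stamp_le x).trans (by omega)
    · exact he2.stamp_le
    · rcases htake x hx with hx | rfl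
      · exact hdec x hx
      · exact hor
    · rw [mul_add]
      simp only [Expr.cost, pair]
      omega
  · rw [Expr.eval, Expr.eval, Expr.eval, v1, v2, e1, e2] at hm
    have hno : (u, v) ∉ S ∧ (v, u) ∉ S := by
      constructor <;> intro h <;> simp [h] at hm
    refine (decideEdge_spec TemporalGraph.weight_comm TemporalGraph.weight_self hB he2
      (harr2 ▸ hfresh) hS hnodup (fun Q h h' => hL.length_arcs_le h h') (harr2 ▸ hu) (harr2 ▸ hv)
      ⟨by omega, hno⟩ ((hreg2 3 (by omega)).trans h3)).mono ?_
    rintro t' s' ⟨g1, g2, g3⟩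
    have hr2 : s'.reg 2 = j := (g1 2 (by omega)).trans he2.index
    refine .assign ?_ ⟨?_, ?_, fun a ha => ?_, ?_⟩
    · simp only [Expr.Fits, Expr.eval, hr2]
      omega
    · rw [State.setReg_reg, if_neg (by omega), g1 1 (by omega), hreg2 1 (by omega), hlen]
    · simp [State.setReg_reg, Expr.eval, hr2]
    · rw [State.setReg_arr, g2 a (by omega), harr2, harr a ha]
    · have hr3 : (s'.setReg 2 (Expr.eval s' (.add (.reg 2) (.lit 1)))).reg 3 = s'.reg 3 := by
        rw [State.setReg_reg, if_neg (by omega)]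
      rw [hr3]
      rcases g3 with ⟨g3, S', g4, g5, g6, g7, g8, g9⟩ | ⟨g3, g4, g5⟩
      · refine Or.inl ⟨g3, S', ⟨?_, ?_, g4.weight, g4.committed,
          fun x => (g4.stamp_le x).trans (by omega)⟩, g4.stamp_le, g5, g6, fun x hx => ?_, ?_⟩
        · rw [State.setReg_reg, if_neg (by omega), g4.size]
        · simp [State.setReg_reg, Expr.eval, hr2]
        · rcases htake x hx with hx | rfl
          · exact (hdec x hx).imp (g7 _) (g7 _)
          · exact g8
        · rw [mul_add]
          simp only [Expr.cost, pair]
          omega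
      · refine Or.inr ⟨g3, g4, ?_⟩
        have : S.length ≤ 2 * L.length := hL.length_arcs_le hnodup fun x hx => hS.pos hx
        have h1 : (1000 * n + 1000) * S.length ≤ (1000 * n + 1000) * (2 * L.length) :=
          Nat.mul_le_mul_left _ this
        have h2 : (1000 * n + 1000) * (4 * L.length) =
            (1000 * n + 1000) * (2 * L.length) + (1000 * n + 1000) * (2 * L.length) := by
          ring
        rw [mul_add, h2]
        simp only [Expr.cost, pair]
        omega

theorem recognize_spec (hL : 𝒢.IsEdgeList L) (hB : ∀ i ≤ L.length, Fit B 𝒢.weight i) :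
    Runs B recognize (inputState n L) fun t s => t ≤ (5000 * n + 6000) * L.length + 40 ∧
      (𝒢.IsTComparability → s.reg 0 = 1) ∧ (¬ 𝒢.IsTComparability → s.reg 0 = 0) := by
  have h0 := (hB L.length le_rfl).index
  refine .seq ((setup_spec hL hB).mono ?_)
  rintro t₀ s₀ ⟨ht₀, hreg, harr, he, h5⟩
  refine .seq (Runs.loop (fun k t s => ∃ j, k = L.length - j ∧ j ≤ L.length ∧ Treated 𝒢 L j t s)
    ?_ ?_ ?_ (k := L.length) ⟨0, by omega, by omega, hreg 1 (by omega), he.index, harr,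
    Or.inl ⟨hreg 3 (by omega), [], he, fun x => (h5 x).le, ?_, by simp, by simp, by simp⟩⟩)
  · rintro k t s ⟨j, -, hj, hlen, hidx, -, hout⟩
    have h3 : s.reg 3 ≤ 1 := by
      rcases hout with h | h <;> omega
    simp only [Expr.Fits, Expr.eval, hidx, hlen]
    split_ifs <;> omega
  · rintro k t s ⟨j, -, hj, hlen, hidx, harr, hout⟩ hexit
    simp only [Expr.eval, hidx, hlen] at hexit
    have hreg0 : (s.setReg 0 (Expr.eval s (.sub (.lit 1) (.reg 3)))).reg 0 = 1 - s.reg 3 := rfl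
    have hj' : (1000 * n + 1500) * j ≤ (1000 * n + 1500) * L.length := Nat.mul_le_mul_left _ hj
    have hsum : (5000 * n + 6000) * L.length = (1000 * n + 1500) * L.length +
        (1000 * n + 1000) * (4 * L.length) + 500 * L.length := by
      ring
    rcases hout with ⟨h3, S, -, -, hS, hnodup, hdec, ht⟩ | ⟨h3, hno, ht⟩
    · obtain rfl : j = L.length := by
        by_contra hne
        rw [h3, if_pos (by omega)] at hexit
        exact one_ne_zero hexit
      refine .assign ⟨show 1 ≤ B by omega, show s.reg 3 ≤ B by omega⟩ ⟨?_, fun _ => ?_, fun h => ?_⟩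
      · have h1 : S.length ≤ 4 * L.length := by
          have := hL.length_arcs_le hnodup fun x hx => hS.pos hx
          omega
        have h2 : (1000 * n + 1000) * S.length ≤ (1000 * n + 1000) * (4 * L.length) :=
          Nat.mul_le_mul_left _ h1
        simp only [Expr.cost]
        omega
      · rw [hreg0, h3]
      · refine absurd (TemporalGraph.isTComparability_iff.2 ⟨_, hS.isWeightTTO
          TemporalGraph.weight_comm fun a b hab => ?_⟩) h
        obtain ⟨x, hx, hxe⟩ := hL.exists_mem hab
        have := hdec x (by rwa [List.take_length])
        rw [Sym2.eq_iff] at hxe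
        rcases hxe with ⟨rfl, rfl⟩ | ⟨rfl, rfl⟩
        · exact this
        · exact this.symm
    · refine .assign ⟨show 1 ≤ B by omega, show s.reg 3 ≤ B by omega⟩ ⟨?_, fun h => ?_, fun _ => ?_⟩
      · simp only [Expr.cost]
        omega
      · exact absurd (TemporalGraph.isTComparability_iff.1 h) hno
      · rw [hreg0, h3]
  · rintro k t s ⟨j, rfl, hj, hs⟩ hexit
    simp only [Expr.eval, hs.index, hs.length, mul_ne_zero_iff] at hexit
    have hlt : j < L.length := by
      by_contra hne
      rw [if_neg hne] at hexit
      exact hexit.1 rfl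
    refine (nextEdge_spec hL (hB j hj) hlt hs (by omega)).mono ?_
    rintro t' s' hs'
    exact ⟨L.length - (j + 1), by omega, j + 1, rfl, hlt, hs'⟩
  · exact ⟨by simp, by simp, fun a b h => by simp at h⟩

end TTOProgram

/-- There are one program `P` and one constant `C` such that, for every temporal graph with `n`
vertices, `m` edges, `k` monolabel triangles and labels at most `W`, given by any edge list, `P`
decides whether the graph admits a temporal transitive orientation (answer `1` or `0` in register
`0`) in at most `C * (max (n m) (min (k n) (m ^ 2)) + 1)` steps, on words of size polynomial in
`n + W`. -/
theorem mainTheorem3 :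
    ∃ (P : RAM.Program) (C : ℕ),
      ∀ (n : ℕ) (𝒢 : TemporalGraph (Fin n)) (L : List (Fin n × Fin n × ℕ)) (W : ℕ),
        𝒢.IsEdgeList L → (∀ e, 𝒢.label e ≤ W) →
          ∃ (t : ℕ) (s : RAM.State),
            RAM.Exec ((n + W + 2) ^ C) P (RAM.inputState n L) t s ∧
            t ≤ C * (max (n * 𝒢.numEdges)
              (min (𝒢.numMonolabelTriangles * n) (𝒢.numEdges ^ 2)) + 1) ∧
            (𝒢.IsTComparability → s.reg 0 = 1) ∧
            (¬ 𝒢.IsTComparability → s.reg 0 = 0) := by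
  -- the constant is kept as a variable, for otherwise the power would be evaluated
  obtain ⟨C, hC⟩ : ∃ C, C = 11000 := ⟨_, rfl⟩
  refine ⟨TTOProgram.recognize, C, fun n 𝒢 L W hL hW => ?_⟩
  have hB : (n + W + 2) ^ 4 ≤ (n + W + 2) ^ C := Nat.pow_le_pow_right (by omega) (by omega)
  generalize (n + W + 2) ^ C = B at hB
  have hn : 4 * (n * n) + 10 + W ≤ B := by
    refine le_trans ?_ hB
    have h1 : 2 ^ 2 * (n + W + 2) ^ 2 ≤ (n + W + 2) ^ 2 * (n + W + 2) ^ 2 :=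
      Nat.mul_le_mul_right _ (Nat.pow_le_pow_left (by omega) 2)
    have h2 : (n + W + 2) ^ 4 = (n + W + 2) ^ 2 * (n + W + 2) ^ 2 := by ring
    have h3 : 2 ^ 2 * (n + W + 2) ^ 2 =
        4 * (n * n) + 16 + 16 * W + (8 * (n * W) + 4 * W ^ 2 + 16 * n) := by ring
    omega
  have hm := hL.length_le
  have hfit : ∀ i ≤ L.length, TTOProgram.Fit B 𝒢.weight i := fun i hi =>
    ⟨by omega, fun a b => by have := TemporalGraph.weight_le hW a b; omega, by omega⟩
  obtain ⟨t, s, hex, ht, hyes, hno⟩ := TTOProgram.recognize_spec hL hfit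
  refine ⟨t, s, hex, ht.trans ?_, hyes, hno⟩
  rw [← hL.length_eq, hC]
  have hnm : (5000 * n + 6000) * L.length ≤ 11000 * (n * L.length) := by
    rw [← mul_assoc]
    rcases n.eq_zero_or_pos with rfl | hpos
    · obtain h : L.length = 0 := by omega
      simp [h]
    · exact Nat.mul_le_mul_right _ (by omega)
  have := le_max_left (n * L.length) (min (𝒢.numMonolabelTriangles * n) (L.length ^ 2))
  omega
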